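/- For Borel probability distributions $\mu,\nu$ on $\mathbb{R}^d$ write $\|\mu-\nu\|_1 = 2\sup_{B}|\mu(B)-\nu(B)|$, the supremum over Borel sets $B$ (this is the $L^1$ distance of the densities when they exist), and for a class $\mathcal F$ of distributions let $\mathrm{opt}(\mathcal F,g)=\inf_{f\in\mathcal F}\|f-g\|_1$. For $C>0$ and $m:(0,\infty)^2\to\mathbb{Z}_{\ge 0}$, the class $\mathcal F$ is $C$-agnostic PAC-learnable with sample complexity $m$ if there is a (deterministic, measurable) method that, given $\varepsilon,\delta>0$ and a sample of $m(\varepsilon,\delta)$ points, outputs a probability distribution $\hat g$, such that for every Borel probability distribution $g$ on $\mathbb{R}^d$ (in $\mathcal F$ or not) and all $\varepsilon,\delta>0$, if the sample is drawn i.i.d. from $g$, then with probability at least $1-\delta$ $$\|\hat g-g\|_1\le C\cdot \mathrm{opt}(\mathcal F,g)+\varepsilon .$$ Theorem. Let $\mathcal F_d$ be the class of $d$-dimensional axis-aligned Gaussians, that is, of Gaussian distributions $\mathcal N(\mu,\Sigma)$ on $\mathbb{R}^d$ with $\mu \in \mathbb{R}^d$ and $\Sigma$ diagonal and positive definite. Then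 $\mathcal F_d$ is $3$-agnostic PAC-learnable with $O\big((d+\log(1/\delta))/\varepsilon^2\big)$ samples: there is a universal constant $K>0$ such that for every $d$ the class $\mathcal F_d$ is $3$-agnostic PAC-learnable with some sample complexity $m_d$ satisfying $$m_d(\varepsilon,\delta)\le K\,\frac{d+\log(1/\delta)}{\varepsilon^2}\qquad\text{for all }\varepsilon>0,\ 0<\delta<1 .$$ -/

import Mathlib

open MeasureTheory ProbabilityTheory

noncomputable section

namespace DensityEstimation

/-- Total variation distance between two probability distributions:
`sup_B |μ(B) - ν(B)|` over all measurable sets `B`. -/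
def tvDist {X : Type*} [MeasurableSpace X] (μ ν : ProbabilityMeasure X) : ℝ :=
  ⨆ B : {B : Set X // MeasurableSet B},
    |(μ : Measure X).real (B : Set X) - (ν : Measure X).real (B : Set X)|

/-- The `L¹` distance between two probability distributions, that is, twice the total variation
distance. It equals the integral of `|f - g|` when the distributions have densities `f` and `g`,
and it makes sense for arbitrary distributions. -/
def l1Dist {X : Type*} [MeasurableSpace X] (μ ν : ProbabilityMeasure X) : ℝ :=
  2 * tvDist μ ν

/-- The `L¹` distance from a distribution `g` to a (nonempty) class `F` of distributions. -/
def opt {X : Type*} [MeasurableSpace X] (F : Set (ProbabilityMeasure X))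
    (g : ProbabilityMeasure X) : ℝ :=
  ⨅ f : F, l1Dist (f : ProbabilityMeasure X) g

/-- `h` is an `(ε, C)`-approximation of `g` with respect to the class `F`. -/
def IsApproximation {X : Type*} [MeasurableSpace X] (F : Set (ProbabilityMeasure X)) (ε C : ℝ)
    (g h : ProbabilityMeasure X) : Prop :=
  l1Dist h g ≤ C * opt F g + ε

/-- The method `A`, which, given `ε`, `δ` and a sample of `m ε δ` points, outputs a probability
distribution, is a `C`-agnostic PAC-learner for `F` with sample complexity `m`:
its output depends measurably on the sample, and for every target distribution `g` (in `F` or not)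
and all `ε, δ > 0`, the probability over an i.i.d. sample of size `m ε δ` from `g` that the output
fails to be an `(ε, C)`-approximation of `g` is at most `δ`. -/
def IsAgnosticPACLearner {X : Type*} [MeasurableSpace X] (C : ℝ) (F : Set (ProbabilityMeasure X))
    (m : ℝ → ℝ → ℕ) (A : (ε δ : ℝ) → (Fin (m ε δ) → X) → ProbabilityMeasure X) : Prop :=
  ∀ ε δ : ℝ, 0 < ε → 0 < δ →
    (Measurable fun S : Fin (m ε δ) → X => (A ε δ S : Measure X)) ∧
    ∀ g : ProbabilityMeasure X,
      Measure.pi (fun _ : Fin (m ε δ) => (g : Measure X))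
        {S | ¬ IsApproximation F ε C g (A ε δ S)} ≤ ENNReal.ofReal δ

/-- `F` is `C`-agnostic PAC-learnable with sample complexity `m`. -/
def AgnosticPACLearnable {X : Type*} [MeasurableSpace X] (C : ℝ) (F : Set (ProbabilityMeasure X))
    (m : ℝ → ℝ → ℕ) : Prop :=
  ∃ A : (ε δ : ℝ) → (Fin (m ε δ) → X) → ProbabilityMeasure X, IsAgnosticPACLearner C F m A

/-- The class of `d`-dimensional axis-aligned Gaussians: the (nondegenerate) Gaussian distributions
on `ℝ^d` whose covariance matrix is diagonal. -/
def axisAlignedGaussians (d : ℕ) : Set (ProbabilityMeasure (EuclideanSpace ℝ (Fin d))) :=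
  {N | ∃ (c : EuclideanSpace ℝ (Fin d)) (V : Matrix (Fin d) (Fin d) ℝ),
    V.PosDef ∧ V.IsDiag ∧
      (N : Measure (EuclideanSpace ℝ (Fin d))) = multivariateGaussian c V}

end DensityEstimation

end

/-! The estimate is a minimum distance estimate over a countable `L¹`-dense sequence of Gaussians `e
i`. If `p i` is the density of `e i`, the distance between `e i` and `e j` is attained on the
comparison set `{p j < p i}`. Choose the candidate whose probabilities best match the empirical
frequencies over all comparison sets. If those frequencies are uniformly within `t` of the
probabilities under `g`, the triangle inequality bounds the error of the chosen candidate by three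
times that of any competitor, up to multiples of `t` and of the slack in the minimization
(`l1Dist_le_of_discrepancy_le`).

It remains to make `t` of order `ε` with `O((d + log (1/δ)) / ε²)` samples, for arbitrary `g`. The
logarithm of a ratio of two axis-aligned Gaussian densities is a combination of the `2 * d + 1`
functions `1`, `x i`, `x i ^ 2`, so the comparison sets have Vapnik-Chervonenkis dimension at most
`2 * d + 1` (`growthBound_pos`).

A union bound over traces would cost an extra `log (1/ε)`. Chaining avoids it: the traces on a
sample have packing numbers bounded independently of the sample size (`GrowthBound.log_card_le`),
which controls the exponential moments of the Rademacher supremum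
(`GrowthBound.sum_exp_iSup_radSum_le`). Symmetrization and a Chernoff bound then give
`GrowthBound.measure_exists_deviation_le`. -/

noncomputable section

namespace DensityEstimation

/-! ### Packing numbers and chaining for Rademacher sums. -/

section

open Finset Real
open scoped Classical

/-- The indices `i` such that the point `y i` belongs to `A`. -/
def trace {X : Type*} {n : ℕ} (y : Fin n → X) (A : Set X) : Finset (Fin n) :=
  univ.filter fun i => y i ∈ A

lemma mem_trace {X : Type*} {n : ℕ} {y : Fin n → X} {A : Set X} {i : Fin n} :
    i ∈ trace y A ↔ y i ∈ A := by simp [trace]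

/-- The family `𝒜` cuts out at most `exp (m x) / x ^ D` subsets of any `m` points, for all
`0 < x ≤ 1`, as families of Vapnik-Chervonenkis dimension at most `D` do. -/
def GrowthBound {ι X : Type*} (𝒜 : ι → Set X) (D : ℕ) : Prop :=
  ∀ (m : ℕ) (y : Fin m → X) (N : Finset (Finset (Fin m))),
    (∀ T ∈ N, ∃ a, T = trace y (𝒜 a)) →
    ∀ x : ℝ, 0 < x → x ≤ 1 → (#N : ℝ) ≤ exp (m * x) / x ^ D

/-- Probabilistic method. Uniform random points all miss a given symmetric difference with
probability at most `(1 - ε) ^ m ≤ exp (-ε m) ≤ 1 / #N ^ 2`, and there are only `#N ^ 2 - #N`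
ordered pairs of distinct members. -/
lemma exists_separating_points {n m : ℕ} (N : Finset (Finset (Fin n))) (hN : N.Nonempty) {ε : ℝ}
    (hε : ε ≤ 1)
    (hsep : ∀ S ∈ N, ∀ T ∈ N, S ≠ T → n * ε ≤ #(symmDiff S T)) (hn : 0 < n)
    (hm : 2 * log #N ≤ ε * m) :
    ∃ p : Fin m → Fin n, ∀ S ∈ N, ∀ T ∈ N, S ≠ T → ∃ j, p j ∈ symmDiff S T := by
  by_contra! hcon
  have hcover : (univ : Finset (Fin m → Fin n)) ⊆
      N.offDiag.biUnion fun q => Fintype.piFinset fun _ : Fin m => (symmDiff q.1 q.2)ᶜ := by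
    intro p _
    obtain ⟨S, hS, T, hT, hne, hj⟩ := hcon p
    refine mem_biUnion.2 ⟨(S, T), mem_offDiag.2 ⟨hS, hT, hne⟩, ?_⟩
    exact Fintype.mem_piFinset.2 fun j => mem_compl.2 (hj j)
  have h1 := (card_le_card hcover).trans card_biUnion_le
  have hN1 : (0 : ℝ) < #N := by exact_mod_cast hN.card_pos
  have hnm : (0 : ℝ) < (n : ℝ) ^ m := by positivity
  have h2 : ((n : ℝ)) ^ m ≤ ∑ q ∈ N.offDiag, ((n : ℝ) ^ m * (1 - ε) ^ m) := by
    have h1' : ((n : ℝ)) ^ m ≤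
        ∑ q ∈ N.offDiag, (#((symmDiff q.1 q.2)ᶜ) : ℝ) ^ m := by
      have : (#(univ : Finset (Fin m → Fin n)) : ℝ) = (n : ℝ) ^ m := by simp
      rw [← this]
      have h1c : (#(univ : Finset (Fin m → Fin n)) : ℝ) ≤ ((∑ q ∈ N.offDiag,
        #(Fintype.piFinset fun _ : Fin m => (symmDiff q.1 q.2)ᶜ) : ℕ) : ℝ) := by exact_mod_cast h1
      refine h1c.trans (le_of_eq ?_)
      push_cast
      refine sum_congr rfl fun q _ => ?_
      simp [Fintype.card_piFinset]
    refine h1'.trans (sum_le_sum fun q hq => ?_)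
    rw [mem_offDiag] at hq
    rw [← mul_pow]
    refine pow_le_pow_left₀ (by positivity) ?_ m
    have := hsep _ hq.1 _ hq.2.1 hq.2.2
    rw [card_compl, Nat.cast_sub (card_le_univ _), Fintype.card_fin]
    linarith
  rw [sum_const, offDiag_card, nsmul_eq_mul,
    Nat.cast_sub (Nat.le_mul_of_pos_left _ hN.card_pos)] at h2
  push_cast at h2
  have h3 : (1 - ε) ^ m ≤ ((#N : ℝ) * #N)⁻¹ := by
    calc (1 - ε) ^ m ≤ (exp (-ε)) ^ m :=
          pow_le_pow_left₀ (by linarith) (by linarith [add_one_le_exp (-ε)]) m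
      _ = exp (-(ε * m)) := by rw [← exp_nat_mul]; ring_nf
      _ ≤ exp (-(2 * log #N)) := exp_le_exp.2 (by linarith)
      _ = ((#N : ℝ) * #N)⁻¹ := by
          rw [exp_neg, two_mul, exp_add, exp_log hN1]
  have h4 : (0 : ℝ) ≤ (#N : ℝ) * #N - #N := by
    have : (1 : ℝ) ≤ #N := by exact_mod_cast hN.card_pos
    nlinarith
  have h5 : (n : ℝ) ^ m ≤ (n : ℝ) ^ m * (((#N : ℝ) * #N - #N) * ((#N : ℝ) * #N)⁻¹) := by
    calc (n : ℝ) ^ m ≤ _ := h2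
      _ = (n : ℝ) ^ m * (((#N : ℝ) * #N - #N) * (1 - ε) ^ m) := by ring
      _ ≤ _ := by gcongr
  have h6 : ((#N : ℝ) * #N - #N) * ((#N : ℝ) * #N)⁻¹ < 1 := by
    rw [← div_eq_mul_inv, div_lt_one (by positivity)]
    linarith
  nlinarith

/-- A self-bounding argument: about `2 * log #N / ε` points already tell the members of `N` apart,
so the growth bound applies to that many points instead of `n`, and `log #N` appears on both sides
with a smaller coefficient on the right. -/
lemma GrowthBound.log_card_le {ι X : Type*} {𝒜 : ι → Set X} {D : ℕ} (h𝒜 : GrowthBound 𝒜 D)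
    (hD : 1 ≤ D) {n : ℕ} (y : Fin n → X) (N : Finset (Finset (Fin n)))
    (hN : ∀ T ∈ N, ∃ a, T = trace y (𝒜 a)) (k : ℕ)
    (hsep : ∀ S ∈ N, ∀ T ∈ N, S ≠ T → (n : ℝ) / 2 ^ k < #(symmDiff S T)) :
    log #N ≤ D * (k + 4) := by
  rcases le_or_gt (#N) 1 with h1 | h1
  · have : log #N ≤ 0 := log_nonpos (by positivity) (by exact_mod_cast h1)
    exact this.trans (by positivity)
  have hne : N.Nonempty := card_pos.1 (by omega)
  have hn : 0 < n := by
    rcases Nat.eq_zero_or_pos n with rfl | h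
    · obtain ⟨S, hS, T, hT, hST⟩ := one_lt_card.1 h1
      exact absurd (Subsingleton.elim S T) hST
    · exact h
  set ε : ℝ := (1 / 2) ^ k with hε
  have hε0 : 0 < ε := by positivity
  have hε1 : ε ≤ 1 := pow_le_one₀ (by norm_num) (by norm_num)
  have hεk : (n : ℝ) / 2 ^ k = n * ε := by rw [hε, one_div, inv_pow]; rfl
  have hlog : 0 ≤ log #N := log_nonneg (by exact_mod_cast h1.le)
  set m : ℕ := ⌈2 * log #N / ε⌉₊ with hm
  have hm1 : 2 * log #N ≤ ε * m := by
    have := Nat.le_ceil (2 * log #N / ε)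
    rw [div_le_iff₀ hε0] at this
    rw [mul_comm ε]; exact this
  have hm2 : ε * m ≤ 2 * log #N + 1 := by
    have := (Nat.ceil_lt_add_one (show 0 ≤ 2 * log #N / ε by positivity)).le
    rw [← hm] at this
    calc ε * m ≤ ε * (2 * log #N / ε + 1) := by gcongr
      _ = 2 * log #N + ε := by field_simp
      _ ≤ _ := by linarith
  obtain ⟨p, hp⟩ := exists_separating_points N hne hε1
    (fun S hS T hT h => by rw [← hεk]; exact (hsep S hS T hT h).le) hn hm1
  have hinj : Set.InjOn (fun T : Finset (Fin n) => trace p (T : Set (Fin n))) N := by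
    intro S hS T hT hST
    by_contra hne
    obtain ⟨j, hj⟩ := hp S hS T hT hne
    have := Finset.ext_iff.1 hST j
    simp only [mem_trace, mem_coe] at this
    rw [mem_symmDiff] at hj
    tauto
  -- With `x = ε / 8` the exponent `m * x` is at most `log #N / 4 + 1 / 8`, which the left side
  -- absorbs.
  have hcard := h𝒜 m (y ∘ p) (N.image fun T : Finset (Fin n) => trace p (T : Set (Fin n))) (by
    intro T' hT'
    obtain ⟨T, hT, rfl⟩ := mem_image.1 hT'
    obtain ⟨a, ha⟩ := hN T hT
    refine ⟨a, ?_⟩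
    ext j
    simp [mem_trace, ha]) (ε / 8) (by positivity) (by linarith)
  rw [card_image_of_injOn hinj] at hcard
  have hN1 : (0 : ℝ) < #N := by exact_mod_cast hne.card_pos
  have h2 := log_le_log hN1 hcard
  rw [log_div (exp_pos _).ne' (by positivity), log_exp, log_pow] at h2
  have h3 : log (ε / 8) = -((k + 3) * log 2) := by
    rw [hε, log_div (by positivity) (by norm_num), log_pow, one_div, log_inv,
      show (8 : ℝ) = 2 ^ 3 by norm_num, log_pow]
    push_cast; ring
  rw [h3] at h2
  have hl2 : log 2 ≤ 0.6931471808 := log_two_lt_d9.le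
  have hD' : (1 : ℝ) ≤ D := by exact_mod_cast hD
  have h4 : (D : ℝ) * ((k + 3) * log 2) ≤ D * ((k + 3) * 0.6931471808) := by gcongr
  have h5 : 0 ≤ (D : ℝ) * k := by positivity
  nlinarith

/-- The sign `±1` encoded by a Boolean. -/
def sgn (b : Bool) : ℝ := if b then 1 else -1

/-- Independence of the signs factors the sum into hyperbolic cosines, and `cosh a ≤ exp (a ^ 2 /
2)`. -/
lemma sum_exp_sgn_le {n : ℕ} (a : Fin n → ℝ) :
    ∑ σ : Fin n → Bool, exp (∑ i, sgn (σ i) * a i) ≤ 2 ^ n * exp ((∑ i, a i ^ 2) / 2) := by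
  have h1 : ∑ σ : Fin n → Bool, exp (∑ i, sgn (σ i) * a i) =
      ∏ i, ∑ b : Bool, exp (sgn b * a i) := by
    rw [Finset.prod_univ_sum, Fintype.piFinset_univ]
    exact sum_congr rfl fun σ _ => exp_sum _ _
  have h2 : ∀ i, ∑ b : Bool, exp (sgn b * a i) = 2 * cosh (a i) := by
    intro i
    rw [Fintype.sum_bool, cosh_eq]
    simp [sgn]
    ring
  rw [h1, sum_div, exp_sum]
  calc ∏ i, ∑ b : Bool, exp (sgn b * a i) ≤ ∏ i, 2 * exp (a i ^ 2 / 2) := by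
        refine prod_le_prod (fun i _ => sum_nonneg fun _ _ => (exp_pos _).le) fun i _ => ?_
        rw [h2]
        gcongr
        exact cosh_le_exp_half_sq _
    _ = _ := by simp [prod_mul_distrib]

lemma sum_exp_abs_sgn_le {n : ℕ} (a : Fin n → ℝ) (μ : ℝ) :
    ∑ σ : Fin n → Bool, exp (μ * |∑ i, sgn (σ i) * a i|) ≤
      2 * 2 ^ n * exp (μ ^ 2 * (∑ i, a i ^ 2) / 2) := by
  have key : ∀ ν : ℝ, ν ^ 2 = μ ^ 2 → ∑ σ : Fin n → Bool, exp (ν * ∑ i, sgn (σ i) * a i) ≤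
      2 ^ n * exp (μ ^ 2 * (∑ i, a i ^ 2) / 2) := by
    intro ν hν
    have := sum_exp_sgn_le fun i => ν * a i
    simp_rw [mul_pow, hν, ← mul_sum, mul_left_comm _ ν, ← mul_sum] at this
    exact this
  have h1 := key μ rfl
  have h2 := key (-μ) (by ring)
  calc ∑ σ : Fin n → Bool, exp (μ * |∑ i, sgn (σ i) * a i|)
      ≤ ∑ σ : Fin n → Bool, (exp (μ * ∑ i, sgn (σ i) * a i) +
          exp (-μ * ∑ i, sgn (σ i) * a i)) := by
        refine sum_le_sum fun σ _ => ?_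
        rcases abs_cases (∑ i, sgn (σ i) * a i) with ⟨h, _⟩ | ⟨h, _⟩ <;> rw [h]
        · linarith [exp_pos (-μ * ∑ i, sgn (σ i) * a i)]
        · rw [mul_neg, ← neg_mul]
          linarith [exp_pos (μ * ∑ i, sgn (σ i) * a i)]
    _ ≤ _ := by rw [sum_add_distrib]; linarith

lemma card_symmDiff_eq_sum {n : ℕ} (S T : Finset (Fin n)) :
    (#(symmDiff S T) : ℝ) =
      ∑ i, ((if i ∈ T then (1 : ℝ) else 0) - (if i ∈ S then 1 else 0)) ^ 2 := by
  have h : ∀ i, ((if i ∈ T then (1 : ℝ) else 0) - (if i ∈ S then 1 else 0)) ^ 2 =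
      if i ∈ symmDiff S T then 1 else 0 := by
    intro i
    by_cases h1 : i ∈ S <;> by_cases h2 : i ∈ T <;> simp [mem_symmDiff, h1, h2]
  simp_rw [h]
  simp

lemma exists_maximal_separated {n : ℕ} (P : Finset (Fin n) → Prop) (r : ℝ) (hr : 0 ≤ r) :
    ∃ N : Finset (Finset (Fin n)), (∀ T ∈ N, P T) ∧
      (∀ S ∈ N, ∀ T ∈ N, S ≠ T → r < #(symmDiff S T)) ∧
      ∀ T, P T → ∃ S ∈ N, (#(symmDiff S T) : ℝ) ≤ r := by
  let Q : Finset (Finset (Finset (Fin n))) := univ.filter fun N => (∀ T ∈ N, P T) ∧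
      (∀ S ∈ N, ∀ T ∈ N, S ≠ T → r < #(symmDiff S T))
  obtain ⟨N, hN⟩ := Q.exists_maximal ⟨∅, by simp [Q]⟩
  have hNQ : N ∈ Q := hN.1
  simp only [Q, mem_filter, mem_univ, true_and] at hNQ
  refine ⟨N, hNQ.1, hNQ.2, fun T hT => ?_⟩
  by_contra! hcon
  have hmem : insert T N ∈ Q := by
    simp only [Q, mem_filter, mem_univ, true_and, mem_insert, forall_eq_or_imp]
    refine ⟨⟨hT, hNQ.1⟩, ⟨fun h => absurd rfl h, fun S hS _ => ?_⟩, fun S hS =>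
      ⟨fun _ => hcon S hS, hNQ.2 S hS⟩⟩
    rw [symmDiff_comm]; exact hcon S hS
  have hTN : T ∈ N := hN.2 hmem (subset_insert _ _) (mem_insert_self _ _)
  have := hcon T hTN
  simp at this
  linarith

lemma GrowthBound.exists_nets {ι X : Type*} {𝒜 : ι → Set X} {D : ℕ} (h𝒜 : GrowthBound 𝒜 D)
    (hD : 1 ≤ D) {n : ℕ} (y : Fin n → X) :
    ∃ (net : ℕ → Finset (Finset (Fin n))) (pr : ℕ → ι → Finset (Fin n)),
      (∀ k, log #(net k) ≤ D * (k + 4)) ∧ (∀ k a, pr k a ∈ net k) ∧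
      (∀ k a, (#(symmDiff (pr k a) (trace y (𝒜 a))) : ℝ) ≤ n / 2 ^ k) ∧ ∀ a, pr 0 a = ∅ := by
  choose N hNP hNsep hNcov using fun k : ℕ =>
    exists_maximal_separated (fun T => ∃ a, T = trace y (𝒜 a)) ((n : ℝ) / 2 ^ k) (by positivity)
  choose ρ hρN hρ using fun (k : ℕ) (a : ι) => hNcov k (trace y (𝒜 a)) ⟨a, rfl⟩
  -- At scale `0` the radius is `n`, so the empty set alone is a net. Chains thus start where the
  -- Rademacher sum vanishes.
  refine ⟨fun k => if k = 0 then {∅} else N k, fun k a => if k = 0 then ∅ else ρ k a,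
    fun k => ?_, fun k a => ?_, fun k a => ?_, fun a => if_pos rfl⟩
  · by_cases hk : k = 0
    · simp [hk]
    · simp only [hk, if_false]
      exact h𝒜.log_card_le hD y (N k) (hNP k) k (hNsep k)
  · by_cases hk : k = 0
    · simp [hk]
    · simp [hk, hρN]
  · by_cases hk : k = 0
    · simp only [hk, if_true, pow_zero, div_one]
      exact_mod_cast (card_le_univ _).trans_eq (Fintype.card_fin n)
    · simp only [hk, if_false]
      exact hρ k a

lemma sum_geometric_weights (L : ℕ) :
    ∑ k ∈ range L, (1 / 4 : ℝ) * (3 / 4) ^ k = 1 - (3 / 4) ^ L := by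
  induction L with
  | zero => simp
  | succ L ih => rw [sum_range_succ, ih, pow_succ]; ring

lemma sum_linear_geometric_weights (L : ℕ) :
    ∑ k ∈ range L, (1 / 4 : ℝ) * (3 / 4) ^ k * (k + 2) = 5 - (3 / 4) ^ L * (L + 5) := by
  induction L with
  | zero => simp
  | succ L ih => rw [sum_range_succ, ih, pow_succ]; push_cast; ring

/-- Jensen's inequality for `exp` at the points `u k / w k - b k`. It turns the exponential of a
chain of increments into a sum over levels, with `exp (- b k)` available to pay for the number of
links at level `k`. -/
lemma exp_sum_le_weighted {L : ℕ} (w u b : ℕ → ℝ) (hw : ∀ k, 0 < w k)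
    (hw1 : ∑ k ∈ range L, w k ≤ 1) :
    exp (∑ k ∈ range L, u k) ≤ exp (∑ k ∈ range L, w k * b k) *
      (∑ k ∈ range L, w k * (exp (- b k) * exp (u k / w k)) + (1 - ∑ k ∈ range L, w k)) := by
  have hj := convexOn_exp.map_sum_le (t := insert L (range L))
    (w := fun k => if k = L then 1 - ∑ k ∈ range L, w k else w k)
    -- The extra index `L` carries the unused mass `1 - ∑ w k`, placed at the point `0`.
    (p := fun k => if k = L then 0 else u k / w k - b k) (by
      intro k _
      by_cases hk : k = L
      · simp only [hk, if_true]; linarith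
      · simp only [hk, if_false]; exact (hw k).le) (by
      rw [sum_insert (by simp)]
      have : ∑ k ∈ range L, (if k = L then 1 - ∑ k ∈ range L, w k else w k) =
          ∑ k ∈ range L, w k :=
        sum_congr rfl fun k hk => if_neg (mem_range.1 hk).ne
      rw [this]; simp) (by simp)
  rw [sum_insert (by simp), sum_insert (by simp)] at hj
  have e1 : ∑ k ∈ range L, (if k = L then 1 - ∑ k ∈ range L, w k else w k) •
      (if k = L then 0 else u k / w k - b k) = ∑ k ∈ range L, u k - ∑ k ∈ range L, w k * b k := by
    rw [← sum_sub_distrib]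
    refine sum_congr rfl fun k hk => ?_
    have := (hw k).ne'
    rw [if_neg (mem_range.1 hk).ne, if_neg (mem_range.1 hk).ne, smul_eq_mul]
    field_simp
  have e2 : ∑ k ∈ range L, (if k = L then 1 - ∑ k ∈ range L, w k else w k) •
      exp (if k = L then 0 else u k / w k - b k) =
      ∑ k ∈ range L, w k * (exp (- b k) * exp (u k / w k)) := by
    refine sum_congr rfl fun k hk => ?_
    rw [if_neg (mem_range.1 hk).ne, if_neg (mem_range.1 hk).ne, smul_eq_mul, ← exp_add]
    ring_nf
  rw [e1, e2] at hj
  simp only [if_true, exp_zero, smul_eq_mul, mul_one, mul_zero, zero_add] at hj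
  calc exp (∑ k ∈ range L, u k)
      = exp (∑ k ∈ range L, w k * b k) *
        exp (∑ k ∈ range L, u k - ∑ k ∈ range L, w k * b k) := by rw [← exp_add]; ring_nf
    _ ≤ _ := by gcongr; linarith

/-- The Rademacher sum over the indices in `T`. -/
def radSum {n : ℕ} (σ : Fin n → Bool) (T : Finset (Fin n)) : ℝ :=
  ∑ i, sgn (σ i) * (if i ∈ T then 1 else 0)

lemma sum_exp_abs_radSum_sub_le {n : ℕ} (S T : Finset (Fin n)) (μ : ℝ) :
    ∑ σ : Fin n → Bool, exp (μ * |radSum σ T - radSum σ S|) ≤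
      2 * 2 ^ n * exp (μ ^ 2 * #(symmDiff S T) / 2) := by
  rw [card_symmDiff_eq_sum]
  refine le_trans (le_of_eq ?_) (sum_exp_abs_sgn_le _ μ)
  simp only [radSum, ← sum_sub_distrib, ← mul_sub]

/-- Telescope along the chain, then replace each increment's exponential by the sum over all links
of its level. The right side no longer depends on the chain, so it also bounds the supremum over
chains. -/
lemma exp_abs_radSum_le_sum_links {n L : ℕ} (σ : Fin n → Bool) (w b : ℕ → ℝ) (hw : ∀ k, 0 < w k)
    (hw1 : ∑ k ∈ range L, w k ≤ 1) (links : ℕ → Finset (Finset (Fin n) × Finset (Fin n)))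
    (c : ℕ → Finset (Fin n)) (hc0 : c 0 = ∅) (hc : ∀ k, (c k, c (k + 1)) ∈ links k) {l : ℝ}
    (hl : 0 ≤ l) :
    exp (l * |radSum σ (c L)|) ≤ exp (∑ k ∈ range L, w k * b k) *
      (∑ k ∈ range L, w k * (exp (- b k) * ∑ q ∈ links k,
        exp (l / w k * |radSum σ q.2 - radSum σ q.1|)) + (1 - ∑ k ∈ range L, w k)) := by
  have h1 : |radSum σ (c L)| ≤ ∑ k ∈ range L, |radSum σ (c (k + 1)) - radSum σ (c k)| := by
    have h2 := sum_range_sub (fun k => radSum σ (c k)) L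
    rw [show radSum σ (c 0) = 0 by simp [radSum, hc0], sub_zero] at h2
    rw [← h2]
    exact abs_sum_le_sum_abs _ _
  have h3 : exp (l * |radSum σ (c L)|) ≤
      exp (∑ k ∈ range L, l * |radSum σ (c (k + 1)) - radSum σ (c k)|) := by
    rw [← mul_sum]; gcongr
  have h5 := exp_sum_le_weighted w (fun k => l * |radSum σ (c (k + 1)) - radSum σ (c k)|) b hw hw1
  have h4 : ∀ k, exp (l * |radSum σ (c (k + 1)) - radSum σ (c k)| / w k) ≤
      ∑ q ∈ links k, exp (l / w k * |radSum σ q.2 - radSum σ q.1|) := by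
    intro k
    rw [mul_div_right_comm]
    have h0 : ∀ q ∈ links k, 0 ≤ exp (l / w k * |radSum σ q.2 - radSum σ q.1|) :=
      fun q _ => (exp_pos _).le
    have h7 := single_le_sum h0 (hc k)
    exact h7
  refine h3.trans (h5.trans (mul_le_mul_of_nonneg_left ?_ (exp_pos _).le))
  have h6 : ∑ k ∈ range L, w k * (exp (- b k) *
      exp (l * |radSum σ (c (k + 1)) - radSum σ (c k)| / w k)) ≤
      ∑ k ∈ range L, w k * (exp (- b k) * ∑ q ∈ links k,
        exp (l / w k * |radSum σ q.2 - radSum σ q.1|)) :=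
    sum_le_sum fun k _ => mul_le_mul_of_nonneg_left
      (mul_le_mul_of_nonneg_left (h4 k) (exp_pos _).le) (hw k).le
  linarith

/-- Chaining bound for the exponential moments of the supremum of a Rademacher process. -/
theorem GrowthBound.sum_exp_iSup_radSum_le {ι X : Type*} [Finite ι] [Nonempty ι] {𝒜 : ι → Set X}
    {D : ℕ} (h𝒜 : GrowthBound 𝒜 D) (hD : 1 ≤ D) {n : ℕ} (y : Fin n → X) (l : ℝ) (hl : 0 ≤ l) :
    ∑ σ : Fin n → Bool, exp (l * ⨆ a, |radSum σ (trace y (𝒜 a))|) ≤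
      2 ^ n * exp (25 * D + 16 * n * l ^ 2) := by
  obtain ⟨net, pr, hnet, hpr, hdist, hpr0⟩ := h𝒜.exists_nets hD y
  -- The ratio `3 / 4` has square above `1 / 2`, so the level variance `(l / w k) ^ 2 * n / 2 ^ k`
  -- decays like `(8 / 9) ^ k`. The `b k` dominate the logarithm of twice the number of links, and
  -- `∑ w k * b k ≤ 25 * D`.
  set w : ℕ → ℝ := fun k => (1 / 4 : ℝ) * (3 / 4) ^ k with hw
  set b : ℕ → ℝ := fun k => D * (5 * (k + 2)) with hb
  have hw0 : ∀ k, 0 < w k := fun k => by positivity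
  have hD' : (1 : ℝ) ≤ D := by exact_mod_cast hD
  have hsumw : ∑ k ∈ range n, w k ≤ 1 := by
    rw [hw, sum_geometric_weights]; linarith [pow_pos (show (0 : ℝ) < 3 / 4 by norm_num) n]
  let links : ℕ → Finset (Finset (Fin n) × Finset (Fin n)) := fun k =>
    ((net k) ×ˢ (net (k + 1))).filter fun q => (#(symmDiff q.1 q.2) : ℝ) ≤ 2 * (n / 2 ^ k)
  have hlink : ∀ k a, (pr k a, pr (k + 1) a) ∈ links k := by
    intro k a
    refine mem_filter.2 ⟨mem_product.2 ⟨hpr k a, hpr _ a⟩, ?_⟩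
    have h1 := hdist k a
    have h2 := hdist (k + 1) a
    have h3 : (n : ℝ) / 2 ^ (k + 1) ≤ n / 2 ^ k := by
      gcongr
      · norm_num
      · omega
    have h4 : #(symmDiff (pr k a) (pr (k + 1) a)) ≤
        #(symmDiff (pr k a) (trace y (𝒜 a))) + #(symmDiff (pr (k + 1) a) (trace y (𝒜 a))) := by
      rw [symmDiff_comm (pr (k + 1) a)]
      exact (card_le_card (symmDiff_triangle _ _ _)).trans (card_union_le _ _)
    have h5 : (#(symmDiff (pr k a) (pr (k + 1) a)) : ℝ) ≤
        #(symmDiff (pr k a) (trace y (𝒜 a))) + #(symmDiff (pr (k + 1) a) (trace y (𝒜 a))) := by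
      exact_mod_cast h4
    show (#(symmDiff (pr k a) (pr (k + 1) a)) : ℝ) ≤ _
    linarith
  have hcard : ∀ k, 2 * (#(links k) : ℝ) ≤ exp (b k) := by
    intro k
    have hN : ∀ k, (#(net k) : ℝ) ≤ exp (D * (k + 4)) := by
      intro k
      have hpos : (0 : ℝ) < #(net k) := by
        have : (net k).Nonempty := ⟨_, hpr k (Classical.arbitrary ι)⟩
        exact_mod_cast this.card_pos
      rw [← log_le_iff_le_exp hpos]
      exact hnet k
    have h1 : (#(links k) : ℝ) ≤ #(net k) * #(net (k + 1)) := by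
      exact_mod_cast (card_filter_le _ _).trans_eq (card_product _ _)
    calc 2 * (#(links k) : ℝ) ≤ exp 1 * (exp (D * (k + 4)) * exp (D * ((k + 1 : ℕ) + 4))) := by
          gcongr
          · linarith [add_one_le_exp (1 : ℝ)]
          · exact h1.trans (by gcongr <;> exact hN _)
      _ ≤ exp (b k) := by
          rw [← exp_add, ← exp_add]
          apply exp_le_exp.2
          rw [hb]
          push_cast
          have : 0 ≤ (D : ℝ) * k := by positivity
          nlinarith
  -- Since `n / 2 ^ n < 1` and a cardinality is an integer, the approximation at level `n` is exact
  -- and the chain may stop there.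
  have hfinal : ∀ a, pr n a = trace y (𝒜 a) := by
    intro a
    have h1 := hdist n a
    have h2 : (n : ℝ) / 2 ^ n < 1 := by
      rw [div_lt_one (by positivity)]
      exact_mod_cast Nat.lt_two_pow_self
    have h3 : #(symmDiff (pr n a) (trace y (𝒜 a))) < 1 := by exact_mod_cast h1.trans_lt h2
    have h4 := card_eq_zero.1 (Nat.lt_one_iff.1 h3)
    exact symmDiff_eq_bot.1 h4
  set R : ℝ := exp (∑ k ∈ range n, w k * b k) with hR
  have hpoint : ∀ σ : Fin n → Bool, exp (l * ⨆ a, |radSum σ (trace y (𝒜 a))|) ≤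
      R * (∑ k ∈ range n, w k * (exp (- b k) * ∑ q ∈ links k,
        exp (l / w k * |radSum σ q.2 - radSum σ q.1|)) + (1 - ∑ k ∈ range n, w k)) := by
    intro σ
    obtain ⟨a, ha⟩ := exists_eq_ciSup_of_finite (f := fun a => |radSum σ (trace y (𝒜 a))|)
    rw [← ha, ← hfinal a]
    exact exp_abs_radSum_le_sum_links σ w b hw0 hsumw links (fun k => pr k a) (hpr0 a)
      (fun k => hlink k a) hl
  have hlevel : ∀ k, exp (- b k) * ∑ q ∈ links k, ∑ σ : Fin n → Bool,
      exp (l / w k * |radSum σ q.2 - radSum σ q.1|) ≤ 2 ^ n * exp (16 * n * l ^ 2) := by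
    intro k
    have h1 : ∀ q ∈ links k, ∑ σ : Fin n → Bool,
        exp (l / w k * |radSum σ q.2 - radSum σ q.1|) ≤ 2 * 2 ^ n * exp (16 * n * l ^ 2) := by
      intro q hq
      refine (sum_exp_abs_radSum_sub_le q.1 q.2 _).trans ?_
      gcongr
      have h2 := (mem_filter.1 hq).2
      calc (l / w k) ^ 2 * (#(symmDiff q.1 q.2) : ℝ) / 2
          ≤ (l / w k) ^ 2 * (2 * (n / 2 ^ k)) / 2 := by gcongr
        _ = 16 * n * l ^ 2 * (8 / 9) ^ k := by
            rw [hw]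
            simp only [div_pow, mul_pow]
            rw [show (8 : ℝ) = 2 * 4 by norm_num, show (9 : ℝ) = 3 * 3 by norm_num]
            simp only [mul_pow]
            field_simp
            rw [show (4 : ℝ) = 2 * 2 by norm_num]
            simp only [mul_pow]
            ring
        _ ≤ 16 * n * l ^ 2 * 1 := by
            gcongr
            exact pow_le_one₀ (by norm_num) (by norm_num)
        _ = _ := by ring
    calc _ ≤ exp (- b k) * ∑ q ∈ links k, 2 * 2 ^ n * exp (16 * n * l ^ 2) := by
          gcongr with q hq
          exact h1 q hq
      _ = (exp (- b k) * (2 * #(links k))) * (2 ^ n * exp (16 * n * l ^ 2)) := by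
          rw [sum_const, nsmul_eq_mul]; ring
      _ ≤ 1 * (2 ^ n * exp (16 * n * l ^ 2)) := by
          gcongr
          rw [exp_neg, inv_mul_le_iff₀ (exp_pos _), mul_one]
          exact hcard k
      _ = _ := one_mul _
  have hRle : R ≤ exp (25 * D) := by
    apply exp_le_exp.2
    have : ∑ k ∈ range n, w k * b k =
        5 * D * ∑ k ∈ range n, (1 / 4 : ℝ) * (3 / 4) ^ k * (k + 2) := by
      rw [mul_sum]
      exact sum_congr rfl fun k _ => by rw [hw, hb]; ring
    rw [this, sum_linear_geometric_weights]
    have h0 : 0 ≤ (3 / 4 : ℝ) ^ n * (n + 5) := by positivity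
    nlinarith
  calc ∑ σ : Fin n → Bool, exp (l * ⨆ a, |radSum σ (trace y (𝒜 a))|)
      ≤ ∑ σ : Fin n → Bool, R * (∑ k ∈ range n, w k * (exp (- b k) * ∑ q ∈ links k,
        exp (l / w k * |radSum σ q.2 - radSum σ q.1|)) + (1 - ∑ k ∈ range n, w k)) :=
        sum_le_sum fun σ _ => hpoint σ
    _ = R * (∑ k ∈ range n, w k * (exp (- b k) * ∑ q ∈ links k, ∑ σ : Fin n → Bool,
        exp (l / w k * |radSum σ q.2 - radSum σ q.1|)) + 2 ^ n * (1 - ∑ k ∈ range n, w k)) := by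
        rw [← mul_sum, sum_add_distrib, sum_comm]
        congr 2
        · refine sum_congr rfl fun k _ => ?_
          rw [← mul_sum, ← mul_sum, sum_comm]
        · simp [mul_sub]
    _ ≤ R * (∑ k ∈ range n, w k * (2 ^ n * exp (16 * n * l ^ 2)) +
          2 ^ n * exp (16 * n * l ^ 2) * (1 - ∑ k ∈ range n, w k)) := by
        refine mul_le_mul_of_nonneg_left (add_le_add (sum_le_sum fun k _ =>
          mul_le_mul_of_nonneg_left (hlevel k) (hw0 k).le)
          (mul_le_mul_of_nonneg_right ?_ (sub_nonneg.2 hsumw))) (exp_pos _).le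
        exact le_mul_of_one_le_right (by positivity) (one_le_exp (by positivity))
    _ = R * (2 ^ n * exp (16 * n * l ^ 2)) := by rw [← sum_mul]; ring
    _ ≤ exp (25 * D) * (2 ^ n * exp (16 * n * l ^ 2)) := by gcongr
    _ = _ := by rw [exp_add]; ring

end

/-! ### Symmetrization and uniform deviation of empirical frequencies. -/

section

open Finset Real
open scoped Classical

variable {ι X : Type*} [MeasurableSpace X]

/-- The real-valued indicator function of a set. -/
def ind {X : Type*} (A : Set X) : X → ℝ := A.indicator fun _ => 1

lemma ind_apply {X : Type*} (A : Set X) (x : X) : ind A x = if x ∈ A then 1 else 0 := by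
  simp [ind, Set.indicator_apply]

lemma measurable_ind {A : Set X} (hA : MeasurableSet A) : Measurable (ind A) :=
  measurable_const.indicator hA

lemma ind_nonneg {X : Type*} (A : Set X) (x : X) : 0 ≤ ind A x := by
  rw [ind_apply]; split_ifs <;> norm_num

lemma ind_le_one {X : Type*} (A : Set X) (x : X) : ind A x ≤ 1 := by
  rw [ind_apply]; split_ifs <;> norm_num

lemma integral_ind {A : Set X} (hA : MeasurableSet A) (g : Measure X) :
    ∫ x, ind A x ∂g = g.real A := by
  simp [ind, integral_indicator hA]

lemma radSum_trace {X : Type*} {n : ℕ} (σ : Fin n → Bool) (y : Fin n → X) (A : Set X) :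
    radSum σ (trace y A) = ∑ i, sgn (σ i) * ind A (y i) := by
  simp [radSum, mem_trace, ind_apply]

lemma abs_sgn (b : Bool) : |sgn b| = 1 := by cases b <;> simp [sgn]

/-- The largest signed deviation between two samples over the sets of a family. -/
def pairDeviation {X : Type*} {n : ℕ} (𝒜 : ι → Set X) (s : Fin n → ℝ) (z : Fin n → X × X) : ℝ :=
  ⨆ a, |∑ i, s i * (ind (𝒜 a) (z i).1 - ind (𝒜 a) (z i).2)|

/-- The largest deviation between the empirical counts of a sample and their expectations, over
the sets of a family. -/
def deviation {n : ℕ} (g : Measure X) (𝒜 : ι → Set X) (x : Fin n → X) : ℝ :=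
  ⨆ a, |∑ i, ind (𝒜 a) (x i) - n * g.real (𝒜 a)|

lemma abs_pairSum_le {X : Type*} {n : ℕ} (A : Set X) (s : Fin n → ℝ) (hs : ∀ i, |s i| = 1)
    (z : Fin n → X × X) : |∑ i, s i * (ind A (z i).1 - ind A (z i).2)| ≤ n := by
  refine (abs_sum_le_sum_abs _ _).trans ?_
  calc ∑ i, |s i * (ind A (z i).1 - ind A (z i).2)| ≤ ∑ _i : Fin n, (1 : ℝ) := by
        refine sum_le_sum fun i _ => ?_
        rw [abs_mul, hs, one_mul, abs_le]
        constructor <;> linarith [ind_nonneg A (z i).1, ind_nonneg A (z i).2, ind_le_one A (z i).1,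
          ind_le_one A (z i).2]
    _ = n := by simp

lemma abs_deviation_le {n : ℕ} (g : Measure X) [IsProbabilityMeasure g] (A : Set X)
    (x : Fin n → X) : |∑ i, ind A (x i) - n * g.real A| ≤ n := by
  have h1 : ∑ i, ind A (x i) ≤ n := by
    calc ∑ i, ind A (x i) ≤ ∑ _i : Fin n, (1 : ℝ) := sum_le_sum fun i _ => ind_le_one _ _
      _ = n := by simp
  have h2 : 0 ≤ ∑ i, ind A (x i) := sum_nonneg fun i _ => ind_nonneg _ _
  have h3 : n * g.real A ≤ n * 1 := by gcongr; exact measureReal_le_one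
  have h4 : 0 ≤ n * g.real A := by positivity
  rw [abs_le]
  constructor <;> linarith

lemma pairDeviation_sgn_le {X : Type*} [Finite ι] [Nonempty ι] {𝒜 : ι → Set X} {n : ℕ} (σ : Fin n → Bool) (z : Fin n → X × X) :
    pairDeviation 𝒜 (fun i => sgn (σ i)) z ≤
      (⨆ a, |radSum σ (trace (fun i => (z i).1) (𝒜 a))|) +
        ⨆ a, |radSum σ (trace (fun i => (z i).2) (𝒜 a))| := by
  refine ciSup_le fun a => ?_
  have h1 := le_ciSup (f := fun a => |radSum σ (trace (fun i => (z i).1) (𝒜 a))|)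
    (Set.finite_range _).bddAbove a
  have h2 := le_ciSup (f := fun a => |radSum σ (trace (fun i => (z i).2) (𝒜 a))|)
    (Set.finite_range _).bddAbove a
  refine le_trans ?_ (add_le_add h1 h2)
  simp only [radSum_trace, mul_sub, sum_sub_distrib]
  exact abs_sub _ _

/-- The mean is the expected count of an independent ghost sample `x'`; Jensen's inequality moves
that expectation outside the exponential. -/
lemma exp_abs_count_sub_le {n : ℕ} {A : Set X} (hA : MeasurableSet A) (g : Measure X)
    [IsProbabilityMeasure g] (x : Fin n → X) {l : ℝ} (hl : 0 ≤ l) :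
    exp (l * |∑ i, ind A (x i) - n * g.real A|) ≤
      ∫ x' : Fin n → X, exp (l * |∑ i, 1 * (ind A (x i) - ind A (x' i))|)
        ∂Measure.pi fun _ : Fin n => g := by
  set φ : (Fin n → X) → ℝ := fun x' => l * |∑ i, 1 * (ind A (x i) - ind A (x' i))| with hφ
  have hmeas := measurable_ind hA
  have hφm : Measurable φ := by fun_prop
  have hφle : ∀ x' : Fin n → X, |∑ i, 1 * (ind A (x i) - ind A (x' i))| ≤ n := fun x' =>
    abs_pairSum_le _ _ (by simp) fun i => (x i, x' i)
  have hφi : Integrable φ (Measure.pi fun _ : Fin n => g) := by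
    refine Integrable.of_bound hφm.aestronglyMeasurable (l * n) (.of_forall fun x' => ?_)
    rw [norm_eq_abs, hφ, abs_mul, abs_abs, abs_of_nonneg hl]
    exact mul_le_mul_of_nonneg_left (hφle x') hl
  have hindi : ∀ i, Integrable (fun x' : Fin n → X => ind A (x' i))
      (Measure.pi fun _ : Fin n => g) := fun i =>
    Integrable.of_bound (hmeas.comp (measurable_pi_apply i)).aestronglyMeasurable 1
      (.of_forall fun x' => by
        rw [norm_eq_abs, abs_of_nonneg (ind_nonneg _ _)]; exact ind_le_one _ _)
  have hint : ∀ i, ∫ x' : Fin n → X, ind A (x' i) ∂(Measure.pi fun _ : Fin n => g) =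
      g.real A := by
    intro i
    rw [← integral_ind hA g]
    exact integral_comp_eval (μ := fun _ : Fin n => g) hmeas.aestronglyMeasurable
  have h2 : ∑ i, ind A (x i) - n * g.real A =
      ∫ x' : Fin n → X, ∑ i, 1 * (ind A (x i) - ind A (x' i))
        ∂(Measure.pi fun _ : Fin n => g) := by
    simp_rw [one_mul]
    have hs : ∀ i ∈ univ, Integrable (fun x' : Fin n → X => ind A (x i) - ind A (x' i))
        (Measure.pi fun _ : Fin n => g) := fun i _ => (integrable_const _).sub (hindi i)
    rw [integral_finsetSum _ hs]
    simp_rw [integral_sub (integrable_const _) (hindi _), hint]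
    simp
  calc exp (l * |∑ i, ind A (x i) - n * g.real A|)
      ≤ exp (∫ x', φ x' ∂(Measure.pi fun _ : Fin n => g)) := by
        rw [hφ, integral_const_mul, h2]
        exact exp_le_exp.2 (mul_le_mul_of_nonneg_left abs_integral_le_integral_abs hl)
    _ ≤ ∫ x', exp (φ x') ∂(Measure.pi fun _ : Fin n => g) := by
        refine convexOn_exp.map_integral_le continuous_exp.continuousOn isClosed_univ (by simp) hφi ?_
        refine Integrable.of_bound (measurable_exp.comp hφm).aestronglyMeasurable (exp (l * n))
          (.of_forall fun x' => ?_)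
        rw [norm_eq_abs, Function.comp, abs_exp]
        exact exp_le_exp.2 (mul_le_mul_of_nonneg_left (hφle x') hl)

section Finite

variable [Finite ι] {𝒜 : ι → Set X}

lemma measurable_pairDeviation {n : ℕ} (h𝒜 : ∀ a, MeasurableSet (𝒜 a)) (s : Fin n → ℝ) :
    Measurable (pairDeviation 𝒜 s) := by
  refine Measurable.iSup fun a => ?_
  have := measurable_ind (h𝒜 a)
  fun_prop

lemma measurable_deviation {n : ℕ} (h𝒜 : ∀ a, MeasurableSet (𝒜 a)) (g : Measure X) :
    Measurable (deviation (n := n) g 𝒜) := by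
  refine Measurable.iSup fun a => ?_
  have := measurable_ind (h𝒜 a)
  fun_prop

lemma integrable_exp_of_le {Ω : Type*} [MeasurableSpace Ω] (P : Measure Ω) [IsFiniteMeasure P]
    {f : Ω → ℝ} (hf : Measurable f) (C : ℝ) (hC : ∀ x, f x ≤ C) {l : ℝ} (hl : 0 ≤ l) :
    Integrable (fun x => exp (l * f x)) P := by
  refine Integrable.of_bound (by fun_prop) (exp (l * C)) (.of_forall fun x => ?_)
  rw [norm_eq_abs, abs_exp]
  gcongr
  exact hC x

/-- Swapping the two entries of pair `i` preserves the law of the pairs and flips the sign of the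
`i`-th summand. -/
lemma integral_exp_pairDeviation_sgn {n : ℕ} (h𝒜 : ∀ a, MeasurableSet (𝒜 a)) (g : Measure X)
    [IsProbabilityMeasure g] (l : ℝ) (σ : Fin n → Bool) :
    ∫ z, exp (l * pairDeviation 𝒜 (fun i => sgn (σ i)) z) ∂Measure.pi (fun _ : Fin n => g.prod g) =
      ∫ z, exp (l * pairDeviation 𝒜 (fun _ => 1) z) ∂Measure.pi fun _ : Fin n => g.prod g := by
  have hmp : MeasurePreserving (fun (z : Fin n → X × X) i => if σ i then z i else (z i).swap)
      (Measure.pi fun _ : Fin n => g.prod g) (Measure.pi fun _ : Fin n => g.prod g) := by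
    refine measurePreserving_pi (fun _ => g.prod g) (fun _ => g.prod g)
      (f := fun i q => if σ i then q else q.swap) fun i => ?_
    cases σ i
    · exact Measure.measurePreserving_swap
    · exact MeasurePreserving.id _
  rw [← hmp.map_eq, integral_map hmp.measurable.aemeasurable, hmp.map_eq]
  · congr 1
    ext z
    simp only [pairDeviation]
    congr 3
    ext a
    congr 2
    ext i
    cases σ i <;> simp [sgn]
  · exact (measurable_exp.comp
      ((measurable_pairDeviation h𝒜 _).const_mul l)).aestronglyMeasurable

variable [Nonempty ι]

/-- The family being finite, the supremum is attained at some `a`; the ghost sample bound for that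
single set is then enlarged to the supremum over pairs. -/
lemma integral_exp_deviation_le {n : ℕ} (h𝒜 : ∀ a, MeasurableSet (𝒜 a)) (g : Measure X)
    [IsProbabilityMeasure g] {l : ℝ} (hl : 0 ≤ l) :
    ∫ x, exp (l * deviation g 𝒜 x) ∂Measure.pi (fun _ : Fin n => g) ≤
      ∫ z, exp (l * pairDeviation 𝒜 (fun _ => 1) z) ∂Measure.pi fun _ : Fin n => g.prod g := by
  have hmp := measurePreserving_arrowProdEquivProdArrow X X (Fin n) (fun _ => g) (fun _ => g)
  set H : (Fin n → X) × (Fin n → X) → ℝ := fun q =>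
    exp (l * pairDeviation 𝒜 (fun _ => 1) fun i => (q.1 i, q.2 i)) with hH
  have hHm : Measurable H := by
    have := (measurable_pairDeviation h𝒜 (fun _ : Fin n => 1)).comp
      (show Measurable fun q : (Fin n → X) × (Fin n → X) => fun i => (q.1 i, q.2 i) by fun_prop)
    exact measurable_exp.comp (this.const_mul l)
  have hpd : ∀ z : Fin n → X × X, pairDeviation 𝒜 (fun _ => 1) z ≤ n := fun z =>
    ciSup_le fun a => abs_pairSum_le _ _ (by simp) _
  have hHi : Integrable H ((Measure.pi fun _ : Fin n => g).prod (Measure.pi fun _ : Fin n => g)) := by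
    refine Integrable.of_bound hHm.aestronglyMeasurable (exp (l * n)) (.of_forall fun x => ?_)
    rw [norm_eq_abs, abs_exp]
    exact exp_le_exp.2 (mul_le_mul_of_nonneg_left (hpd _) hl)
  have h1 : ∫ z, exp (l * pairDeviation 𝒜 (fun _ => 1) z) ∂Measure.pi (fun _ : Fin n => g.prod g) =
      ∫ q, H q ∂(Measure.pi fun _ : Fin n => g).prod (Measure.pi fun _ : Fin n => g) := by
    rw [← hmp.integral_comp (MeasurableEquiv.measurableEmbedding _)]
    rfl
  rw [h1, integral_prod _ hHi]
  refine integral_mono (integrable_exp_of_le _ (measurable_deviation h𝒜 g) n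
    (fun x => ciSup_le fun a => abs_deviation_le g _ x) hl) hHi.integral_prod_left fun x => ?_
  obtain ⟨a, ha⟩ := exists_eq_ciSup_of_finite
    (f := fun a => |∑ i, ind (𝒜 a) (x i) - n * g.real (𝒜 a)|)
  have h2 : exp (l * deviation g 𝒜 x) =
      exp (l * |∑ i, ind (𝒜 a) (x i) - n * g.real (𝒜 a)|) := by rw [deviation, ← ha]
  have h3 : Integrable (fun x' => H (x, x')) (Measure.pi fun _ : Fin n => g) := by
    refine Integrable.of_bound (hHm.comp measurable_prodMk_left).aestronglyMeasurable
      (exp (l * n)) (.of_forall fun x' => ?_)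
    rw [norm_eq_abs]
    simp only [hH, abs_exp]
    exact exp_le_exp.2 (mul_le_mul_of_nonneg_left (hpd _) hl)
  refine h2.trans_le ((exp_abs_count_sub_le (h𝒜 a) g x hl).trans ?_)
  refine integral_mono_of_nonneg (.of_forall fun _ => (exp_pos _).le) h3 (.of_forall fun x' => ?_)
  refine exp_le_exp.2 (mul_le_mul_of_nonneg_left ?_ hl)
  have h4 := le_ciSup (f := fun a => |∑ i, 1 * (ind (𝒜 a) (x i) - ind (𝒜 a) (x' i))|)
    (Set.finite_range _).bddAbove a
  exact h4

/-- Averaging over the signs leaves the integral unchanged. For fixed pairs the signed deviation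
splits into two Rademacher suprema, separated by `2 * u * v ≤ u ^ 2 + v ^ 2` at the price of
replacing `l` by `2 * l`. -/
lemma GrowthBound.integral_exp_pairDeviation_le {D n : ℕ} (h𝒜 : ∀ a, MeasurableSet (𝒜 a))
    (hG : GrowthBound 𝒜 D) (hD : 1 ≤ D) (g : Measure X) [IsProbabilityMeasure g] {l : ℝ}
    (hl : 0 ≤ l) :
    ∫ z, exp (l * pairDeviation 𝒜 (fun _ => 1) z) ∂Measure.pi (fun _ : Fin n => g.prod g) ≤
      exp (25 * D + 64 * n * l ^ 2) := by
  have hpt : ∀ z : Fin n → X × X,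
      ∑ σ : Fin n → Bool, exp (l * pairDeviation 𝒜 (fun i => sgn (σ i)) z) ≤
        2 ^ n * exp (25 * D + 64 * n * l ^ 2) := by
    intro z
    have h1 := hG.sum_exp_iSup_radSum_le hD (fun i => (z i).1) (2 * l) (by positivity)
    have h2 := hG.sum_exp_iSup_radSum_le hD (fun i => (z i).2) (2 * l) (by positivity)
    have e : 25 * (D : ℝ) + 16 * n * (2 * l) ^ 2 = 25 * D + 64 * n * l ^ 2 := by ring
    rw [e] at h1 h2
    have h3 : ∀ σ : Fin n → Bool, 2 * exp (l * pairDeviation 𝒜 (fun i => sgn (σ i)) z) ≤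
        exp (2 * l * ⨆ a, |radSum σ (trace (fun i => (z i).1) (𝒜 a))|) +
          exp (2 * l * ⨆ a, |radSum σ (trace (fun i => (z i).2) (𝒜 a))|) := by
      intro σ
      set u := ⨆ a, |radSum σ (trace (fun i => (z i).1) (𝒜 a))|
      set v := ⨆ a, |radSum σ (trace (fun i => (z i).2) (𝒜 a))|
      have h4 : exp (l * pairDeviation 𝒜 (fun i => sgn (σ i)) z) ≤ exp (l * u) * exp (l * v) := by
        rw [← exp_add, ← mul_add]
        exact exp_le_exp.2 (mul_le_mul_of_nonneg_left (pairDeviation_sgn_le σ z) hl)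
      have h5 : ∀ u : ℝ, exp (2 * l * u) = exp (l * u) ^ 2 := by
        intro u; rw [← exp_nat_mul]; push_cast; ring_nf
      rw [h5, h5]
      nlinarith [sq_nonneg (exp (l * u) - exp (l * v))]
    have h6 := sum_le_sum fun σ (_ : σ ∈ univ) => h3 σ
    rw [← mul_sum, sum_add_distrib] at h6
    linarith
  have hi : ∀ σ : Fin n → Bool, Integrable
      (fun z => exp (l * pairDeviation 𝒜 (fun i => sgn (σ i)) z))
      (Measure.pi fun _ : Fin n => g.prod g) := fun σ =>
    integrable_exp_of_le _ (measurable_pairDeviation h𝒜 _) n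
      (fun z => ciSup_le fun a => abs_pairSum_le _ _ (fun i => abs_sgn _) z) hl
  have h7 : ∫ z, ∑ σ : Fin n → Bool, exp (l * pairDeviation 𝒜 (fun i => sgn (σ i)) z)
      ∂Measure.pi (fun _ : Fin n => g.prod g) ≤
      ∫ _z, 2 ^ n * exp (25 * D + 64 * n * l ^ 2) ∂Measure.pi (fun _ : Fin n => g.prod g) :=
    integral_mono (integrable_finsetSum _ fun σ _ => hi σ) (integrable_const _) hpt
  rw [integral_finsetSum _ fun σ _ => hi σ] at h7
  simp_rw [integral_exp_pairDeviation_sgn h𝒜 g l] at h7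
  simp only [sum_const, card_univ, Fintype.card_fun, Fintype.card_bool, Fintype.card_fin,
    nsmul_eq_mul, Nat.cast_pow, Nat.cast_ofNat, integral_const, probReal_univ, one_smul] at h7
  exact le_of_mul_le_mul_left h7 (by positivity)

lemma GrowthBound.measureReal_deviation_le {D n : ℕ} (h𝒜 : ∀ a, MeasurableSet (𝒜 a))
    (hG : GrowthBound 𝒜 D) (hD : 1 ≤ D) (g : Measure X) [IsProbabilityMeasure g] {t : ℝ}
    (ht : 0 ≤ t) :
    (Measure.pi fun _ : Fin n => g).real {x | n * t ≤ deviation g 𝒜 x} ≤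
      exp (25 * D - n * t ^ 2 / 256) := by
  -- The value `l = t / 128` minimizes the Chernoff exponent `64 * n * l ^ 2 - l * n * t`.
  have hl : 0 ≤ t / 128 := by positivity
  refine (measure_ge_le_exp_mul_mgf (n * t) hl (integrable_exp_of_le _ (measurable_deviation h𝒜 g) n
    (fun x => ciSup_le fun a => abs_deviation_le g _ x) hl)).trans ?_
  have h := (integral_exp_deviation_le (n := n) h𝒜 g hl).trans
    (hG.integral_exp_pairDeviation_le (n := n) h𝒜 hD g hl)
  calc _ ≤ exp (-(t / 128) * (n * t)) * exp (25 * D + 64 * n * (t / 128) ^ 2) :=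
        mul_le_mul_of_nonneg_left h (exp_pos _).le
    _ = _ := by rw [← exp_add]; ring_nf

end Finite

/-- Uniform convergence of empirical frequencies to probabilities over a countable family of sets,
without logarithmic loss. -/
theorem GrowthBound.measure_exists_deviation_le {D n : ℕ} {𝒜 : ℕ → Set X}
    (h𝒜 : ∀ a, MeasurableSet (𝒜 a)) (hG : GrowthBound 𝒜 D) (hD : 1 ≤ D) (g : Measure X)
    [IsProbabilityMeasure g] {t : ℝ} (ht : 0 ≤ t) :
    Measure.pi (fun _ : Fin n => g)
      {x | ∃ a, n * t ≤ |∑ i, ind (𝒜 a) (x i) - n * g.real (𝒜 a)|} ≤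
      ENNReal.ofReal (exp (25 * D - n * t ^ 2 / 256)) := by
  have hU : {x : Fin n → X | ∃ a, n * t ≤ |∑ i, ind (𝒜 a) (x i) - n * g.real (𝒜 a)|} =
      ⋃ N : ℕ, {x | ∃ a ≤ N, n * t ≤ |∑ i, ind (𝒜 a) (x i) - n * g.real (𝒜 a)|} := by
    ext x
    simp only [Set.mem_ofPred_eq, Set.mem_iUnion]
    exact ⟨fun ⟨a, h⟩ => ⟨a, a, le_rfl, h⟩, fun ⟨_, a, _, h⟩ => ⟨a, h⟩⟩
  have hmono : Monotone fun N : ℕ =>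
      {x : Fin n → X | ∃ a ≤ N, n * t ≤ |∑ i, ind (𝒜 a) (x i) - n * g.real (𝒜 a)|} :=
    fun N M hNM x ⟨a, ha, h⟩ => ⟨a, ha.trans hNM, h⟩
  -- The bound for finite subfamilies does not depend on their size, so it passes to the increasing
  -- union.
  rw [hU, hmono.measure_iUnion]
  refine iSup_le fun N => ?_
  have hG' : GrowthBound (fun a : Fin (N + 1) => 𝒜 a) D := fun m y F hF =>
    hG m y F fun T hT => let ⟨a, ha⟩ := hF T hT; ⟨a, ha⟩
  have := hG'.measureReal_deviation_le (n := n) (𝒜 := fun a : Fin (N + 1) => 𝒜 a) (fun a => h𝒜 a) hD g ht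
  rw [measureReal_def] at this
  refine le_trans (measure_mono ?_) ((ENNReal.le_ofReal_iff_toReal_le (measure_ne_top _ _)
    (exp_pos _).le).2 this)
  rintro x ⟨a, ha, h⟩
  have h1 := h.trans (le_ciSup (f := fun a : Fin (N + 1) => |∑ i, ind (𝒜 a) (x i) - n * g.real (𝒜 a)|)
    (Set.finite_range _).bddAbove ⟨a, by omega⟩)
  exact h1

end

/-! ### Vapnik-Chervonenkis bounds for positivity sets. -/

section

open Finset Real
open scoped Classical

lemma sum_choose_le_exp_div_pow (m D : ℕ) {x : ℝ} (hx : 0 < x) (hx1 : x ≤ 1) :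
    ∑ k ∈ Iic D, (m.choose k : ℝ) ≤ exp (m * x) / x ^ D := by
  rw [le_div_iff₀ (by positivity), sum_mul]
  have h1 : ∑ k ∈ Iic D, (m.choose k : ℝ) * x ^ D ≤ ∑ k ∈ Iic D, x ^ k * (m.choose k : ℝ) := by
    refine sum_le_sum fun k hk => ?_
    rw [mul_comm]
    exact mul_le_mul_of_nonneg_right (pow_le_pow_of_le_one hx.le hx1 (mem_Iic.1 hk))
      (by positivity)
  have h2 : ∑ k ∈ Iic D, x ^ k * (m.choose k : ℝ) ≤
      ∑ k ∈ range (m + 1 + D), x ^ k * (m.choose k : ℝ) :=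
    sum_le_sum_of_subset_of_nonneg (fun k hk => by
      rw [mem_Iic] at hk; rw [mem_range]; omega) fun _ _ _ => by positivity
  have h3 : ∑ k ∈ range (m + 1), x ^ k * (m.choose k : ℝ) =
      ∑ k ∈ range (m + 1 + D), x ^ k * (m.choose k : ℝ) :=
    sum_subset (range_mono (by omega)) fun k _ hk => by
      rw [mem_range, not_lt] at hk
      rw [Nat.choose_eq_zero_of_lt (by omega)]; simp
  have h4 : (x + 1) ^ m = ∑ k ∈ range (m + 1), x ^ k * (m.choose k : ℝ) := by
    rw [add_pow]; simp
  calc _ ≤ (x + 1) ^ m := by rw [h4, h3]; exact h1.trans h2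
    _ ≤ exp x ^ m := pow_le_pow_left₀ (by positivity) (add_one_le_exp x) m
    _ = exp (m * x) := by rw [← exp_nat_mul]

/-- The positivity sets of the functions in the span of a finite family shatter at most as many points
as the family has members. -/
lemma card_le_of_shatters_pos {ι κ X : Type*} [Fintype κ] {m : ℕ} (f : κ → X → ℝ) (c : ι → κ → ℝ)
    (y : Fin m → X) (N : Finset (Finset (Fin m)))
    (hN : ∀ T ∈ N, ∃ a, T = trace y {x | 0 < ∑ j, c a j * f j x}) (s : Finset (Fin m))
    (hs : N.Shatters s) : #s ≤ Fintype.card κ := by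
  by_contra! hlt
  let L : (s → ℝ) →ₗ[ℝ] (κ → ℝ) := Matrix.mulVecLin (Matrix.of fun j (i : s) => f j (y i))
  -- With more points than functions, some nonzero weights on the points annihilate the whole span;
  -- up to sign, one weight is positive.
  have hker : ∃ u : s → ℝ, L u = 0 ∧ ∃ i, 0 < u i := by
    have h1 : LinearMap.ker L ≠ ⊥ := LinearMap.ker_ne_bot_of_finrank_lt (by simpa using hlt)
    obtain ⟨u, hu, hu0⟩ := (Submodule.ne_bot_iff _).1 h1
    obtain ⟨i, hi⟩ := Function.ne_iff.1 hu0
    rcases lt_or_gt_of_ne hi with h | h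
    · exact ⟨-u, by rw [map_neg, LinearMap.mem_ker.1 hu, neg_zero], i, by simpa using h⟩
    · exact ⟨u, LinearMap.mem_ker.1 hu, i, h⟩
  obtain ⟨u, hu, i₀, hi₀⟩ := hker
  -- Cutting out exactly the points of positive weight gives a function of the span whose weighted
  -- sum has no negative term and at least one positive term, contradicting that this sum is zero.
  obtain ⟨T, hT, hsT⟩ := hs (t := (univ.filter fun i : s => 0 < u i).map (.subtype _)) (by
    intro i hi
    obtain ⟨j, _, rfl⟩ := mem_map.1 hi
    exact j.2)
  obtain ⟨a, rfl⟩ := hN T hT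
  have hiff : ∀ i : s, 0 < ∑ j, c a j * f j (y i) ↔ 0 < u i := by
    intro i
    have := Finset.ext_iff.1 hsT i
    simpa [mem_trace] using this
  have hsum : ∑ i : s, u i * ∑ j, c a j * f j (y i) = 0 := by
    calc ∑ i : s, u i * ∑ j, c a j * f j (y i) = ∑ j, c a j * L u j := by
          simp only [L, Matrix.mulVecLin_apply, Matrix.mulVec, dotProduct, Matrix.of_apply, mul_sum]
          rw [sum_comm]
          exact sum_congr rfl fun _ _ => sum_congr rfl fun _ _ => by ring
      _ = 0 := by simp [hu]
  refine hsum.not_gt (sum_pos' (fun i _ => ?_) ⟨i₀, mem_univ _, mul_pos hi₀ ((hiff i₀).2 hi₀)⟩)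
  rcases lt_or_ge 0 (u i) with h | h
  · exact (mul_pos h ((hiff i).2 h)).le
  · exact mul_nonneg_of_nonpos_of_nonpos h (not_lt.1 fun h' => h.not_gt ((hiff i).1 h'))

/-- The Sauer-Shelah lemma bounds the number of traces by a sum of binomial coefficients. -/
lemma growthBound_pos {ι κ X : Type*} [Fintype κ] (f : κ → X → ℝ) (c : ι → κ → ℝ) :
    GrowthBound (fun a => {x | 0 < ∑ j, c a j * f j x}) (Fintype.card κ) := by
  intro m y N hN x hx hx1
  have h1 := N.card_le_card_shatterer.trans card_shatterer_le_sum_vcDim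
  have h2 : N.vcDim ≤ Fintype.card κ :=
    Finset.sup_le fun s hs => card_le_of_shatters_pos f c y N hN s (mem_shatterer.1 hs)
  refine le_trans ?_ (sum_choose_le_exp_div_pow m _ hx hx1)
  have h3 : #N ≤ ∑ k ∈ Iic (Fintype.card κ), m.choose k := by
    rw [Fintype.card_fin] at h1
    exact h1.trans (sum_le_sum_of_subset (Iic_subset_Iic.2 h2))
  exact_mod_cast h3

end

section

open Real
open scoped Classical

/-! ### The `L¹` distance, densities and separability. -/

section Distance

variable {X : Type*} [MeasurableSpace X]

lemma abs_measureReal_sub_le_one (μ ν : ProbabilityMeasure X) (B : Set X) :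
    |(μ : Measure X).real B - (ν : Measure X).real B| ≤ 1 := by
  rw [abs_le]
  constructor <;> linarith [measureReal_nonneg (μ := (μ : Measure X)) (s := B),
    measureReal_nonneg (μ := (ν : Measure X)) (s := B),
    measureReal_le_one (μ := (μ : Measure X)) (s := B),
    measureReal_le_one (μ := (ν : Measure X)) (s := B)]

lemma l1Dist_le {μ ν : ProbabilityMeasure X} {c : ℝ}
    (h : ∀ B, MeasurableSet B → |(μ : Measure X).real B - (ν : Measure X).real B| ≤ c) :
    l1Dist μ ν ≤ 2 * c := by
  have : Nonempty {B : Set X // MeasurableSet B} := ⟨⟨∅, .empty⟩⟩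
  exact mul_le_mul_of_nonneg_left (ciSup_le fun B => h B B.2) (by norm_num)

lemma abs_measureReal_sub_le (μ ν : ProbabilityMeasure X) {B : Set X} (hB : MeasurableSet B) :
    2 * |(μ : Measure X).real B - (ν : Measure X).real B| ≤ l1Dist μ ν := by
  refine mul_le_mul_of_nonneg_left ?_ (by norm_num)
  have h : BddAbove (Set.range fun B : {B : Set X // MeasurableSet B} =>
      |(μ : Measure X).real (B : Set X) - (ν : Measure X).real (B : Set X)|) :=
    ⟨1, by rintro _ ⟨B, rfl⟩; exact abs_measureReal_sub_le_one μ ν B⟩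
  exact le_ciSup h ⟨B, hB⟩

lemma l1Dist_nonneg (μ ν : ProbabilityMeasure X) : 0 ≤ l1Dist μ ν :=
  le_trans (by positivity) (abs_measureReal_sub_le μ ν MeasurableSet.empty)

lemma l1Dist_le_two (μ ν : ProbabilityMeasure X) : l1Dist μ ν ≤ 2 :=
  (l1Dist_le fun B _ => abs_measureReal_sub_le_one μ ν B).trans_eq (by norm_num)

lemma l1Dist_triangle (μ ν ρ : ProbabilityMeasure X) :
    l1Dist μ ρ ≤ l1Dist μ ν + l1Dist ν ρ := by
  refine (l1Dist_le (c := (l1Dist μ ν + l1Dist ν ρ) / 2) fun B hB => ?_).trans_eq (by ring)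
  linarith [abs_sub_le ((μ : Measure X).real B) ((ν : Measure X).real B) ((ρ : Measure X).real B),
    abs_measureReal_sub_le μ ν hB, abs_measureReal_sub_le ν ρ hB]

lemma opt_nonneg (F : Set (ProbabilityMeasure X)) (g : ProbabilityMeasure X) : 0 ≤ opt F g :=
  Real.iInf_nonneg fun _ => l1Dist_nonneg _ _

lemma l1Dist_eq_zero_of_subsingleton [Subsingleton X] (μ ν : ProbabilityMeasure X) :
    l1Dist μ ν = 0 := by
  refine le_antisymm ((l1Dist_le (c := 0) fun B _ => ?_).trans_eq (by norm_num)) (l1Dist_nonneg _ _)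
  rcases Set.eq_empty_or_nonempty B with rfl | h
  · simp
  · rw [Subsingleton.eq_univ_of_nonempty h]; simp

/-- `p` is a density of `μ` with respect to `m`. -/
structure HasDensity (m : Measure X) (μ : ProbabilityMeasure X) (p : X → ℝ) : Prop where
  integrable : Integrable p m
  real_eq : ∀ B, MeasurableSet B → (μ : Measure X).real B = ∫ x in B, p x ∂m

variable {m : Measure X} {μ ν : ProbabilityMeasure X} {p q : X → ℝ}

lemma HasDensity.real_sub_eq (hp : HasDensity m μ p) (hq : HasDensity m ν q) {B : Set X}
    (hB : MeasurableSet B) :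
    (μ : Measure X).real B - (ν : Measure X).real B = ∫ x in B, (p x - q x) ∂m := by
  rw [hp.real_eq B hB, hq.real_eq B hB,
    integral_sub hp.integrable.integrableOn hq.integrable.integrableOn]

/-- The `L¹` distance is attained at the set where one density exceeds the other. -/
lemma HasDensity.l1Dist_le_of_lt (hp : HasDensity m μ p) (hq : HasDensity m ν q) {A : Set X}
    (hA : MeasurableSet A) (hpq : ∀ x, x ∈ A ↔ q x < p x) :
    l1Dist μ ν ≤ 2 * |(μ : Measure X).real A - (ν : Measure X).real A| := by
  have key : ∀ B, MeasurableSet B → (μ : Measure X).real B - (ν : Measure X).real B ≤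
      (μ : Measure X).real A - (ν : Measure X).real A := by
    intro B hB
    rw [hp.real_sub_eq hq hB, hp.real_sub_eq hq hA, ← integral_indicator hB,
      ← integral_indicator hA]
    have hi := hp.integrable.sub hq.integrable
    refine integral_mono (hi.indicator hB) (hi.indicator hA) fun x => ?_
    simp only [Set.indicator_apply]
    have := hpq x
    split_ifs with h1 h2 h2
    · exact le_rfl
    · rw [this, not_lt] at h2; linarith
    · rw [this] at h2; linarith
    · exact le_rfl
  refine l1Dist_le fun B hB => abs_le.2 ⟨?_, (key B hB).trans (le_abs_self _)⟩
  -- Complements reverse the sign of the difference, which gives the lower bound.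
  have h1 := key Bᶜ hB.compl
  rw [probReal_compl_eq_one_sub hB, probReal_compl_eq_one_sub hB] at h1
  linarith [le_abs_self ((μ : Measure X).real A - (ν : Measure X).real A)]

/-- The factor `2` is not sharp, but suffices for transferring density of a sequence from `Lp ℝ 1
m`. -/
lemma HasDensity.l1Dist_le_integral (hp : HasDensity m μ p) (hq : HasDensity m ν q) :
    l1Dist μ ν ≤ 2 * ∫ x, |p x - q x| ∂m := by
  refine l1Dist_le fun B hB => ?_
  rw [hp.real_sub_eq hq hB]
  exact abs_integral_le_integral_abs.trans (setIntegral_le_integral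
    (hp.integrable.sub hq.integrable).abs (.of_forall fun _ => abs_nonneg _))

/-- A class of distributions with densities is separable for the `L¹` distance. -/
lemma exists_dense_seq_of_hasDensity {F : Set (ProbabilityMeasure X)} (hF : F.Nonempty)
    (m : Measure X) [SigmaFinite m] [MeasurableSpace.CountablyGenerated X]
    (h : ∀ μ ∈ F, ∃ p, HasDensity m μ p) :
    ∃ e : ℕ → ProbabilityMeasure X, (∀ i, e i ∈ F) ∧
      ∀ μ ∈ F, ∀ η > 0, ∃ i, l1Dist (e i) μ ≤ η := by
  choose! p hp using h
  let T : F → Lp ℝ 1 m := fun μ => (hp μ μ.2).integrable.toL1 (p μ)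
  have : Nonempty F := hF.to_subtype
  have : Nonempty (Set.range T) := (Set.range_nonempty T).to_subtype
  have : Fact ((1 : ENNReal) ≠ ⊤) := ⟨by simp⟩
  -- Subsets of the separable metric space `Lp ℝ 1 m` are separable, so the dense sequence can be
  -- taken inside the class itself.
  obtain ⟨u, hu⟩ := TopologicalSpace.exists_dense_seq (Set.range T)
  choose e he using fun i => (u i).2
  refine ⟨fun i => e i, fun i => (e i).2, fun μ hμ η hη => ?_⟩
  obtain ⟨_, hi, ⟨i, rfl⟩⟩ := Metric.dense_iff.1 hu ⟨T ⟨μ, hμ⟩, ⟨μ, hμ⟩, rfl⟩ (η / 2) (by positivity)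
  refine ⟨i, ((hp _ (e i).2).l1Dist_le_integral (hp μ hμ)).trans ?_⟩
  rw [Metric.mem_ball, Subtype.dist_eq, ← he, dist_eq_norm] at hi
  have h1 : ‖T (e i) - T ⟨μ, hμ⟩‖ = ∫ x, |p (e i) x - p μ x| ∂m := by
    have h2 : T (e i) - T ⟨μ, hμ⟩ =
        ((hp _ (e i).2).integrable.sub (hp μ hμ).integrable).toL1 (p (e i) - p μ) :=
      (Integrable.toL1_sub _ _ _ _).symm
    rw [h2, L1.norm_eq_integral_norm]
    refine integral_congr_ae ?_
    filter_upwards [Integrable.coeFn_toL1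
      ((hp _ (e i).2).integrable.sub (hp μ hμ).integrable)] with x hx
    rw [hx, norm_eq_abs, Pi.sub_apply]
  linarith

end Distance

/-! ### Densities of axis-aligned Gaussians. -/

section Gaussian

variable {d : ℕ}

/-- The monomials `1`, `x i` and `x i ^ 2`. -/
def monomials (d : ℕ) : Unit ⊕ Fin d ⊕ Fin d → EuclideanSpace ℝ (Fin d) → ℝ :=
  Sum.elim (fun _ _ => 1) (Sum.elim (fun i x => x i) fun i x => x i ^ 2)

lemma measurable_monomials (j : Unit ⊕ Fin d ⊕ Fin d) : Measurable (monomials d j) := by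
  rcases j with _ | i | i <;> simp only [monomials, Sum.elim_inl, Sum.elim_inr] <;> fun_prop

lemma pi_gaussianReal_eq_withDensity (c : Fin d → ℝ) (v : Fin d → NNReal) (hv : ∀ i, v i ≠ 0) :
    Measure.pi (fun i => gaussianReal (c i) (v i)) =
      (volume : Measure (Fin d → ℝ)).withDensity
        fun x => ENNReal.ofReal (∏ i, gaussianPDFReal (c i) (v i) (x i)) := by
  refine Measure.pi_eq fun s hs => ?_
  rw [withDensity_apply _ (MeasurableSet.univ_pi hs), volume_pi, Measure.restrict_pi_pi,
    ← ofReal_integral_eq_lintegral_ofReal, integral_fintype_prod_eq_prod,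
    ENNReal.ofReal_prod_of_nonneg]
  · exact Finset.prod_congr rfl fun i _ => (gaussianReal_apply_eq_integral _ (hv i) _).symm
  · exact fun i _ => integral_nonneg fun x => gaussianPDFReal_nonneg _ _ _
  · exact Integrable.fintype_prod fun i => (integrable_gaussianPDFReal _ _).restrict
  · exact .of_forall fun x => Finset.prod_nonneg fun i _ => gaussianPDFReal_nonneg _ _ _

/-- Both sides have the same characteristic function. -/
lemma multivariateGaussian_diagonal (c : EuclideanSpace ℝ (Fin d)) (v : Fin d → NNReal) :
    multivariateGaussian c (Matrix.diagonal fun i => (v i : ℝ)) =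
      (Measure.pi fun i => gaussianReal (c i) (v i)).map (WithLp.toLp 2) := by
  have hS : (Matrix.diagonal fun i => (v i : ℝ)).PosSemidef :=
    Matrix.PosSemidef.diagonal fun i => (v i).2
  apply Measure.ext_of_charFun (E := EuclideanSpace ℝ (Fin d))
  ext t
  rw [charFun_multivariateGaussian hS, charFun_pi]
  simp_rw [charFun_gaussianReal, ← Complex.exp_sum]
  congr 1
  rw [Finset.sum_sub_distrib, PiLp.inner_apply, dotProduct]
  simp only [Matrix.mulVec_diagonal, Complex.ofReal_sum, Finset.sum_mul, Finset.sum_div]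
  congr 1
  · refine Finset.sum_congr rfl fun i _ => ?_
    simp
    ring
  · refine Finset.sum_congr rfl fun i _ => ?_
    push_cast
    ring

lemma gaussianPDFReal_eq_exp (c : ℝ) {v : NNReal} (hv : v ≠ 0) (x : ℝ) :
    gaussianPDFReal c v x =
      exp (-log (√(2 * π * v)) - c ^ 2 / (2 * v) + c / v * x + -1 / (2 * v) * x ^ 2) := by
  have hv' : (0 : ℝ) < v := by exact_mod_cast pos_iff_ne_zero.2 hv
  have h : (√(2 * π * v))⁻¹ = exp (-log (√(2 * π * v))) := by
    rw [exp_neg, exp_log (by positivity)]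
  rw [gaussianPDFReal, h, ← exp_add]
  congr 1
  field_simp
  ring

/-- Axis-aligned Gaussians have densities that are exponentials of linear combinations of
`1`, `x i` and `x i ^ 2`. -/
lemma exists_hasDensity_of_mem_axisAlignedGaussians
    {μ : ProbabilityMeasure (EuclideanSpace ℝ (Fin d))} (hμ : μ ∈ axisAlignedGaussians d) :
    ∃ b : Unit ⊕ Fin d ⊕ Fin d → ℝ,
      HasDensity volume μ fun x => exp (∑ j, b j * monomials d j x) := by
  obtain ⟨c, V, hV, hVd, hμ⟩ := hμ
  let v : Fin d → NNReal := fun i => (V i i).toNNReal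
  have hv : ∀ i, v i ≠ 0 := fun i => (Real.toNNReal_pos.2 hV.diag_pos).ne'
  have hVv : V = Matrix.diagonal fun i => (v i : ℝ) := by
    rw [← hVd.diagonal_diag]
    congr 1
    ext i
    exact (Real.coe_toNNReal (V i i) hV.diag_pos.le).symm
  let b : Unit ⊕ Fin d ⊕ Fin d → ℝ :=
    Sum.elim (fun _ => ∑ i, (-log (√(2 * π * v i)) - c i ^ 2 / (2 * v i)))
      (Sum.elim (fun i => c i / v i) fun i => -1 / (2 * v i))
  have hprod : ∀ x : EuclideanSpace ℝ (Fin d),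
      ∏ i, gaussianPDFReal (c i) (v i) (x i) = exp (∑ j, b j * monomials d j x) := by
    intro x
    simp_rw [gaussianPDFReal_eq_exp _ (hv _), ← exp_sum]
    congr 1
    simp only [Fintype.sum_sum_type, b, monomials, Sum.elim_inl, Sum.elim_inr, Finset.univ_unique,
      Finset.sum_singleton, mul_one, Finset.sum_add_distrib]
    ring
  have hmeas : Measurable fun x : EuclideanSpace ℝ (Fin d) => exp (∑ j, b j * monomials d j x) := by
    have := measurable_monomials (d := d)
    fun_prop
  have hdens : (μ : Measure (EuclideanSpace ℝ (Fin d))) =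
      volume.withDensity fun x => ENNReal.ofReal (exp (∑ j, b j * monomials d j x)) := by
    ext B hB
    rw [hμ, hVv, multivariateGaussian_diagonal, pi_gaussianReal_eq_withDensity _ _ hv,
      Measure.map_apply (by fun_prop) hB, withDensity_apply _ ((WithLp.measurable_toLp 2 _) hB),
      withDensity_apply _ hB,
      ← (PiLp.volume_preserving_toLp (Fin d)).setLIntegral_comp_preimage hB (by fun_prop)]
    simp_rw [← hprod]
  have hfin : ∫⁻ x, ENNReal.ofReal (exp (∑ j, b j * monomials d j x)) = 1 := by
    rw [← setLIntegral_univ, ← withDensity_apply _ MeasurableSet.univ, ← hdens, measure_univ]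
  refine ⟨b, ⟨⟨hmeas.aestronglyMeasurable, ?_⟩, fun B hB => ?_⟩⟩
  · rw [hasFiniteIntegral_iff_ofReal (.of_forall fun _ => (exp_pos _).le), hfin]
    exact ENNReal.one_lt_top
  · rw [integral_eq_lintegral_of_nonneg_ae (.of_forall fun _ => (exp_pos _).le)
      hmeas.aestronglyMeasurable, measureReal_def, hdens, withDensity_apply _ hB]

lemma axisAlignedGaussians_nonempty (d : ℕ) : (axisAlignedGaussians d).Nonempty :=
  ⟨⟨multivariateGaussian 0 1, inferInstance⟩, 0, 1, Matrix.PosDef.one, Matrix.isDiag_one, rfl⟩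

end Gaussian

/-! ### The minimum distance estimate. -/

section MinimumDistance

variable {X : Type*} [MeasurableSpace X] {n : ℕ}

/-- The empirical frequency of a set in a sample. -/
def empiricalFreq (S : Fin n → X) (A : Set X) : ℝ := (∑ i, ind A (S i)) / n

/-- The largest discrepancy between a distribution and the empirical frequencies over a sequence of
sets. -/
def discrepancy (𝒜 : ℕ → Set X) (μ : ProbabilityMeasure X) (S : Fin n → X) : ℝ :=
  ⨆ k, |(μ : Measure X).real (𝒜 k) - empiricalFreq S (𝒜 k)|

lemma abs_sub_empiricalFreq_le (μ : ProbabilityMeasure X) (S : Fin n → X) (A : Set X) :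
    |(μ : Measure X).real A - empiricalFreq S A| ≤ 1 := by
  have h1 : 0 ≤ empiricalFreq S A :=
    div_nonneg (Finset.sum_nonneg fun i _ => ind_nonneg _ _) (by positivity)
  have h2 : empiricalFreq S A ≤ 1 := by
    refine div_le_one_of_le₀ ?_ (by positivity)
    calc ∑ i, ind A (S i) ≤ ∑ _i : Fin n, (1 : ℝ) := Finset.sum_le_sum fun i _ => ind_le_one _ _
      _ = n := by simp
  rw [abs_le]
  constructor <;> linarith [measureReal_nonneg (μ := (μ : Measure X)) (s := A),
    measureReal_le_one (μ := (μ : Measure X)) (s := A)]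

lemma le_discrepancy (𝒜 : ℕ → Set X) (μ : ProbabilityMeasure X) (S : Fin n → X) (k : ℕ) :
    |(μ : Measure X).real (𝒜 k) - empiricalFreq S (𝒜 k)| ≤ discrepancy 𝒜 μ S :=
  le_ciSup (f := fun k => |(μ : Measure X).real (𝒜 k) - empiricalFreq S (𝒜 k)|)
    ⟨1, by rintro _ ⟨k, rfl⟩; exact abs_sub_empiricalFreq_le μ S _⟩ k

lemma measurable_discrepancy {𝒜 : ℕ → Set X} (h𝒜 : ∀ k, MeasurableSet (𝒜 k))
    (μ : ProbabilityMeasure X) : Measurable (discrepancy (n := n) 𝒜 μ) := by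
  refine Measurable.iSup fun k => ?_
  have := measurable_ind (h𝒜 k)
  unfold empiricalFreq
  fun_prop

/-- A measurable choice of an approximate minimizer in a sequence of nonnegative functions. -/
lemma exists_measurable_approx_minimizer {Ω : Type*} [MeasurableSpace Ω] {f : ℕ → Ω → ℝ}
    (hf : ∀ i, Measurable (f i)) (hf0 : ∀ i ω, 0 ≤ f i ω) {η : ℝ} (hη : 0 < η) :
    ∃ sel : Ω → ℕ, Measurable sel ∧ ∀ ω j, f (sel ω) ω ≤ f j ω + η := by
  have hbdd : ∀ ω, BddBelow (Set.range fun i => f i ω) := fun ω =>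
    ⟨0, by rintro _ ⟨i, rfl⟩; exact hf0 i ω⟩
  have hex : ∀ ω, ∃ i, f i ω < (⨅ j, f j ω) + η := fun ω =>
    exists_lt_of_ciInf_lt (lt_add_of_pos_right _ hη)
  -- Taking the least admissible index makes the choice measurable.
  refine ⟨fun ω => Nat.find (hex ω), measurable_find hex fun i => ?_, fun ω j => ?_⟩
  · exact measurableSet_lt (hf i) ((Measurable.iInf hf).add_const η)
  · have h1 := Nat.find_spec (hex ω)
    have h2 : ⨅ j, f j ω ≤ f j ω := ciInf_le (hbdd ω) j
    linarith

/-- The deterministic guarantee of the minimum distance estimate. -/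
lemma l1Dist_le_of_discrepancy_le {e : ℕ → ProbabilityMeasure X} {𝒜 : ℕ → Set X}
    (h𝒜 : ∀ k, MeasurableSet (𝒜 k))
    (he : ∀ i j, ∃ k, l1Dist (e i) (e j) ≤
      2 * |(e i : Measure X).real (𝒜 k) - (e j : Measure X).real (𝒜 k)|)
    (g : ProbabilityMeasure X) (S : Fin n → X) {t η : ℝ}
    (hS : ∀ k, |empiricalFreq S (𝒜 k) - (g : Measure X).real (𝒜 k)| ≤ t) {i j : ℕ}
    (hij : discrepancy 𝒜 (e i) S ≤ discrepancy 𝒜 (e j) S + η) :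
    l1Dist (e i) g ≤ 3 * l1Dist (e j) g + 4 * t + 2 * η := by
  have h1 : discrepancy 𝒜 (e j) S ≤ l1Dist (e j) g / 2 + t := ciSup_le fun k => by
    have h2 := abs_measureReal_sub_le (e j) g (h𝒜 k)
    have h3 := abs_sub_le ((e j : Measure X).real (𝒜 k)) ((g : Measure X).real (𝒜 k))
      (empiricalFreq S (𝒜 k))
    have h4 := hS k
    rw [abs_sub_comm] at h4
    linarith
  -- On the comparison set, `l1Dist (e i) (e j)` is at most twice the sum of the two discrepancies,
  -- hence at most `2 * l1Dist (e j) g + 4 * t + 2 * η`; the triangle inequality adds the third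
  -- `l1Dist (e j) g`.
  obtain ⟨k, hk⟩ := he i j
  have h5 := l1Dist_triangle (e i) (e j) g
  have h6 := abs_sub_le ((e i : Measure X).real (𝒜 k)) (empiricalFreq S (𝒜 k))
    ((e j : Measure X).real (𝒜 k))
  have h7 := le_discrepancy 𝒜 (e i) S k
  have h8 := le_discrepancy 𝒜 (e j) S k
  rw [abs_sub_comm] at h8
  linarith

/-- The minimum distance estimate over a class with an `L¹`-dense sequence whose comparison sets
have bounded growth. -/
theorem exists_minimum_distance_estimator {F : Set (ProbabilityMeasure X)} (hF : F.Nonempty)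
    {e : ℕ → ProbabilityMeasure X} (hdense : ∀ μ ∈ F, ∀ η > 0, ∃ i, l1Dist (e i) μ ≤ η)
    {𝒜 : ℕ → Set X} (h𝒜 : ∀ k, MeasurableSet (𝒜 k))
    (he : ∀ i j, ∃ k, l1Dist (e i) (e j) ≤
      2 * |(e i : Measure X).real (𝒜 k) - (e j : Measure X).real (𝒜 k)|)
    {D : ℕ} (hG : GrowthBound 𝒜 D) (hD : 1 ≤ D) (n : ℕ) {ε : ℝ} (hε : 0 < ε) :
    ∃ A : (Fin n → X) → ProbabilityMeasure X, (Measurable fun S => (A S : Measure X)) ∧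
      (0 < n → ∀ g : ProbabilityMeasure X, Measure.pi (fun _ : Fin n => (g : Measure X))
        {S | ¬ IsApproximation F ε 3 g (A S)} ≤
          ENNReal.ofReal (exp (25 * D - n * (ε / 8) ^ 2 / 256))) := by
  obtain ⟨sel, hsel, hmin⟩ := exists_measurable_approx_minimizer
    (f := fun i S => discrepancy (n := n) 𝒜 (e i) S) (fun i => measurable_discrepancy h𝒜 (e i))
    (fun i S => (abs_nonneg _).trans (le_discrepancy 𝒜 (e i) S 0)) (show 0 < ε / 10 by positivity)
  refine ⟨fun S => e (sel S), ?_, fun hn g => ?_⟩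
  · exact (measurable_from_nat (f := fun i => (e i : Measure X))).comp hsel
  refine le_trans (measure_mono fun S hS => ?_)
    (hG.measure_exists_deviation_le h𝒜 hD (g : Measure X) (show 0 ≤ ε / 8 by positivity))
  by_contra hcon
  refine hS ?_
  simp only [Set.mem_ofPred_eq, not_exists, not_le] at hcon
  have hn' : (0 : ℝ) < n := by exact_mod_cast hn
  have hfreq : ∀ k, |empiricalFreq S (𝒜 k) - (g : Measure X).real (𝒜 k)| ≤ ε / 8 := by
    intro k
    have h1 : ∑ i, ind (𝒜 k) (S i) - n * (g : Measure X).real (𝒜 k) =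
        n * (empiricalFreq S (𝒜 k) - (g : Measure X).real (𝒜 k)) := by
      rw [empiricalFreq]; field_simp
    have h2 := hcon k
    rw [h1, abs_mul, Nat.abs_cast] at h2
    exact (lt_of_mul_lt_mul_left h2 hn'.le).le
  have : Nonempty F := hF.to_subtype
  -- The error budget is `3 * (ε / 10)` for density, `4 * (ε / 8)` for deviation and `2 * (ε / 10)`
  -- for approximate minimization, in total `ε`.
  have h3 : (l1Dist (e (sel S)) g - ε) / 3 ≤ opt F g := le_ciInf fun μ => by
    obtain ⟨j, hj⟩ := hdense μ μ.2 (ε / 10) (by positivity)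
    have h4 := l1Dist_le_of_discrepancy_le h𝒜 he g S hfreq (hmin S j)
    have h5 := l1Dist_triangle (e j) μ g
    linarith
  show l1Dist (e (sel S)) g ≤ 3 * opt F g + ε
  linarith

end MinimumDistance

/-- The minimum distance estimate for axis-aligned Gaussians. -/
theorem exists_axisAlignedGaussian_estimator (d n : ℕ) {ε : ℝ} (hε : 0 < ε) :
    ∃ A : (Fin n → EuclideanSpace ℝ (Fin d)) → ProbabilityMeasure (EuclideanSpace ℝ (Fin d)),
      (Measurable fun S => (A S : Measure (EuclideanSpace ℝ (Fin d)))) ∧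
      (0 < n → ∀ g : ProbabilityMeasure (EuclideanSpace ℝ (Fin d)),
        Measure.pi (fun _ : Fin n => (g : Measure (EuclideanSpace ℝ (Fin d))))
          {S | ¬ IsApproximation (axisAlignedGaussians d) ε 3 g (A S)} ≤
            ENNReal.ofReal (exp (25 * (2 * d + 1) - n * (ε / 8) ^ 2 / 256))) := by
  obtain ⟨e, heF, hdense⟩ := exists_dense_seq_of_hasDensity (axisAlignedGaussians_nonempty d)
    volume fun μ hμ => let ⟨b, hb⟩ := exists_hasDensity_of_mem_axisAlignedGaussians hμ; ⟨_, hb⟩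
  choose b hb using fun i => exists_hasDensity_of_mem_axisAlignedGaussians (heF i)
  -- The index `k` encodes a pair `(i, j)`: density `i` exceeds density `j` exactly where the
  -- difference of their exponents is positive.
  let c : ℕ → Unit ⊕ Fin d ⊕ Fin d → ℝ := fun k => b k.unpair.1 - b k.unpair.2
  let 𝒜 : ℕ → Set (EuclideanSpace ℝ (Fin d)) := fun k => {x | 0 < ∑ j, c k j * monomials d j x}
  have h𝒜 : ∀ k, MeasurableSet (𝒜 k) := fun k => by
    have := measurable_monomials (d := d)
    exact measurableSet_lt measurable_const (by fun_prop)
  have he : ∀ i j, ∃ k, l1Dist (e i) (e j) ≤ 2 *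
      |(e i : Measure (EuclideanSpace ℝ (Fin d))).real (𝒜 k) -
        (e j : Measure (EuclideanSpace ℝ (Fin d))).real (𝒜 k)| := fun i j =>
    ⟨Nat.pair i j, (hb i).l1Dist_le_of_lt (hb j) (h𝒜 _) fun x => by
      simp only [𝒜, c, Nat.unpair_pair, Set.mem_ofPred_eq, Pi.sub_apply, sub_mul,
        Finset.sum_sub_distrib, sub_pos, exp_lt_exp]⟩
  have hcard : Fintype.card (Unit ⊕ Fin d ⊕ Fin d) = 2 * d + 1 := by simp; ring
  have hG : GrowthBound 𝒜 (2 * d + 1) := hcard ▸ growthBound_pos (monomials d) c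
  have := exists_minimum_distance_estimator (axisAlignedGaussians_nonempty d) hdense h𝒜 he hG
    (by omega) n hε
  exact_mod_cast this

/-- Here `2457600 = 2 * 75 * 16384`: `16384 = 8 ^ 2 * 256` clears the denominators, `75 * d`
dominates `25 * (2 * d + 1)`, and the factor `2` pays for the floor, since `1 ≤ d` and `ε ≤ 2` force
`Z ≥ 1 / 4`. -/
lemma exp_estimate_le {d : ℕ} (hd : 1 ≤ d) {ε δ : ℝ} (hε : 0 < ε) (hε2 : ε ≤ 2) (hδ : 0 < δ)
    (hδ1 : δ < 1) {n : ℕ} (hn : n = ⌊2457600 * (((d : ℝ) + log (1 / δ)) / ε ^ 2)⌋₊) :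
    0 < n ∧ exp (25 * (2 * d + 1) - n * (ε / 8) ^ 2 / 256) ≤ δ := by
  have hd' : (1 : ℝ) ≤ d := by exact_mod_cast hd
  have hlog : 0 < log (1 / δ) := log_pos (by rw [lt_div_iff₀ hδ]; linarith)
  set Z : ℝ := ((d : ℝ) + log (1 / δ)) / ε ^ 2 with hZ
  have hZε : Z * ε ^ 2 = d + log (1 / δ) := by rw [hZ]; field_simp
  have hZ1 : 1 / 4 ≤ Z := by
    rw [hZ, le_div_iff₀ (by positivity)]
    nlinarith
  have hn1 : 1228800 * Z ≤ n := by
    have := Nat.lt_floor_add_one (2457600 * Z)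
    rw [← hn] at this
    linarith
  refine ⟨?_, ?_⟩
  · have : (0 : ℝ) < n := by linarith
    exact_mod_cast this
  · rw [← le_log_iff_exp_le hδ]
    have h1 : 1228800 * Z * ε ^ 2 ≤ n * ε ^ 2 := by gcongr
    have h2 : log (1 / δ) = -log δ := by rw [one_div, log_inv]
    rw [mul_assoc, hZε] at h1
    nlinarith

end

end DensityEstimation

end

/-! ### Choice of the sample size and conclusion. -/

theorem mainTheorem4 :
    ∃ K : ℝ, 0 < K ∧ ∀ d : ℕ, ∃ m : ℝ → ℝ → ℕ,
      (∀ ε δ : ℝ, 0 < ε → 0 < δ → δ < 1 →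
        (m ε δ : ℝ) ≤ K * (((d : ℝ) + Real.log (1 / δ)) / ε ^ 2)) ∧
      DensityEstimation.AgnosticPACLearnable 3 (DensityEstimation.axisAlignedGaussians d) m := by
  refine ⟨2457600, by norm_num, fun d =>
    ⟨fun ε δ => ⌊2457600 * (((d : ℝ) + Real.log (1 / δ)) / ε ^ 2)⌋₊, fun ε δ hε hδ hδ1 => ?_, ?_⟩⟩
  · have hlog : 0 < Real.log (1 / δ) := Real.log_pos (by rw [lt_div_iff₀ hδ]; linarith)
    exact Nat.floor_le (by positivity)
  · choose A hAm hA using fun (n : ℕ) (ε : ℝ) (hε : 0 < ε) =>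
      DensityEstimation.exists_axisAlignedGaussian_estimator d n hε
    refine ⟨fun ε δ => if hε : 0 < ε then A _ ε hε else A _ 1 one_pos, fun ε δ hε hδ => ?_⟩
    simp only [hε, dif_pos]
    refine ⟨hAm _ ε hε, fun g => ?_⟩
    -- In these cases the sample may be empty, but any output works: distances vanish on a point,
    -- never exceed `2`, and probabilities never exceed `1`.
    by_cases htriv : d = 0 ∨ 2 < ε ∨ 1 ≤ δ
    · rcases htriv with rfl | h | h
      · refine (measure_mono (t := ∅) fun S hS => (hS ?_).elim).trans (by simp)
        rw [DensityEstimation.IsApproximation,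
          DensityEstimation.l1Dist_eq_zero_of_subsingleton]
        linarith [DensityEstimation.opt_nonneg (DensityEstimation.axisAlignedGaussians 0) g]
      · refine (measure_mono (t := ∅) fun S hS => (hS ?_).elim).trans (by simp)
        rw [DensityEstimation.IsApproximation]
        linarith [DensityEstimation.opt_nonneg (DensityEstimation.axisAlignedGaussians d) g,
          DensityEstimation.l1Dist_le_two (A _ ε hε S) g]
      · exact prob_le_one.trans (ENNReal.one_le_ofReal.2 h)
    · push Not at htriv
      obtain ⟨hn, hexp⟩ := DensityEstimation.exp_estimate_le
        (Nat.one_le_iff_ne_zero.2 htriv.1) hε htriv.2.1 hδ htriv.2.2 rfl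
      exact (hA _ ε hε hn g).trans (ENNReal.ofReal_le_ofReal hexp)
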